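/- Setting. Consider a two-player zero-sum imperfect-information extensive-form game with horizon $H\ge 1$, given as a finite partially observable Markov game. A state $s_1$ is drawn from $p_0$. At each step $h=1,\dots,H$ the max-player observes only the infoset $x_h=x(s_h)\in\mathcal X_h$ and chooses $a_h\in\mathcal A$. The min-player observes only $y_h=y(s_h)\in\mathcal Y_h$ and chooses $b_h\in\mathcal B$. A random reward $r_h\in[0,1]$ with a distribution depending on $(s_h,a_h,b_h)$ is generated, and for $h<H$ the next state is drawn from $p_h(\cdot\mid s_h,a_h,b_h)$. The max-player maximizes and the min-player minimizes $V^{\mu,\nu}=\mathbb E_{\mu,\nu}[\sum_{h=1}^H r_h]$. The game has tree structure (each $s_{h+1}$ has a unique predecessor $(s_h,a_h,b_h)$) and perfect recall (each $x_{h+1}$ has a unique predecessor $(x_h,a_h)$, and likewise for the min-player). Every infoset contains a state. Write $X=\sum_h|\mathcal X_h|$, $Y=\sum_h|\mathcal Y_h|$, $A=|\mathcal A|\ge1$, $B=|\mathcal B|\ge1$. A policy $\mu$ of the max-player consists of distributions $\mu_h(\cdot\mid x_h)$ on $\mathcal A$. Its sequence form is $\mu_{1:h}(x_h,a_h)=\prod_{h'\le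 h}\mu_{h'}(a_{h'}\mid x_{h'})$ along the unique history of $(x_h,a_h)$. Put $$\mathrm{NEGap}(\mu,\nu)=\max_{\mu^\dagger}V^{\mu^\dagger,\nu}-\min_{\nu^\dagger}V^{\mu,\nu^\dagger},$$ the max and min being over all policies. Algorithm (Balanced CFR with Hedge and parameter $\eta$, max-player). Let $\mathcal C_h(x_{h'},a_{h'})$ be the set of infosets of step $h$ reachable from $(x_{h'},a_{h'})$, and $\mathcal C_h(x_{h'})=\bigcup_a\mathcal C_h(x_{h'},a)$. The balanced exploration policy $\mu^{\star,h}$ is $\mu^{\star,h}_{h'}(a\mid x_{h'})=|\mathcal C_h(x_{h'},a)|/|\mathcal C_h(x_{h'})|$ for $h'<h$ and $1/A$ for $h'\ge h$. Start with $\mu^1$ uniform. In round $t$, for each $h\in[H]$ an episode is played with $\mu^{t,(h)}=(\mu^{\star,h}_{1:h}\,\mu^t_{h+1:H})$, and from the observed trajectory $(x^{t,(h)}_{h'},a^{t,(h)}_{h'},r^{t,(h)}_{h'})_{h'\le H}$ one forms $$\widetilde L^t_h(x_h,a_h)=\frac{\mathbf 1\{(x^{t,(h)}_h,a^{t,(h)}_h)=(x_h,a_h)\}}{\mu^{\star,h}_{1:h}(x_h,a_h)}\Big(H-h+1-\sum_{h'=h}^H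 r^{t,(h)}_{h'}\Big).$$ Then $$\mu^{t+1}_h(a\mid x_h)\propto_a\mu^t_h(a\mid x_h)\exp\big(-\eta\,\mu^{\star,h}_{1:h}(x_h,a)\,\widetilde L^t_h(x_h,a)\big).$$ The min-player's version is symmetric, with $1-r$ in place of $r$. In self-play, in each round $t$ the max-player first plays $\mu^{t,(1)},\dots,\mu^{t,(H)}$ against the fixed $\nu^t$, and then the min-player plays $\nu^{t,(1)},\dots,\nu^{t,(H)}$ against the fixed $\mu^t$. Thus $T$ rounds consist of $2HT$ episodes. Claim. There are absolute constants $C,C'>0$ such that the following holds for all such games, all $\varepsilon>0$ and all $\delta\in(0,1)$. Let $\iota=\log(10(XA+YB)/\delta)$. (1) Suppose that both players play Balanced CFR with Hedge in self-play for $T$ rounds, the max-player with $\eta=\sqrt{XA\,\iota_X/(H^3T)}$ and the min-player with $\eta=\sqrt{YB\,\iota_Y/(H^3T)}$, where $\iota_X\in[\log(10XA/\delta),\iota]$ and $\iota_Y\in[\log(10YB/\delta),\iota]$. If $$T\ge C\,H^3(XA+YB)\,\iota/\varepsilon^2,$$ then with probability at least $1-\delta$ the average policies $(\bar\mu,\bar\nu)=(\frac1T\sum_{t=1}^T\mu^t,\frac1T\sum_{t=1}^T\nu^t)$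 (averaged in sequence form) satisfy $\mathrm{NEGap}(\bar\mu,\bar\nu)\le\varepsilon$. (2) If $\varepsilon\le H$, then for the smallest such number of rounds, $T=\lceil C\,H^3(XA+YB)\,\iota/\varepsilon^2\rceil$, the total number of episodes is $2H\cdot T\le C'\,H^4(XA+YB)\,\iota/\varepsilon^2$. -/

import Mathlib

open MeasureTheory ProbabilityTheory

noncomputable section

/-- The tree of information sets of one player with perfect recall. Steps are numbered
`0, 1, 2, …`; `X h` is the set of infosets of step `h` and `A` the set of actions.
Every infoset of step `h + 1` has a unique preceding pair (infoset of step `h`, action). -/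
structure InfoTree (X : ℕ → Type*) (A : Type*) where
  par : ∀ h, X (h + 1) → X h × A

/-- A behaviour in conditional form: `μ h x a` stands for `μ_h(a | x)`. -/
abbrev Plan (X : ℕ → Type*) (A : Type*) := ∀ h, X h → A → ℝ

/-- A plan is a policy for the steps `0, …, H - 1` if `μ_h(· | x)` is a probability vector at
every infoset `x` of every step `h < H`. -/
def IsPolicy (H : ℕ) {X : ℕ → Type*} {A : Type*} [Fintype A] (μ : Plan X A) : Prop :=
  ∀ h < H, ∀ x : X h, (∀ a, 0 ≤ μ h x a) ∧ ∑ a, μ h x a = 1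

namespace InfoTree

variable {X : ℕ → Type*} {A : Type*} (I : InfoTree X A)

/-- The history of an infoset: all (infoset, action) pairs that precede it, latest first. -/
def hist : ∀ h, X h → List (Σ h, X h × A)
  | 0, _ => []
  | h + 1, x => ⟨h, I.par h x⟩ :: hist h (I.par h x).1

/-- `C_k(x, a)`: the infosets of step `k` that are reachable from the infoset `x` of step `h`
and the action `a`. -/
def descAct (k : ℕ) {h : ℕ} (x : X h) (a : A) : Set (X k) :=
  {x' | (⟨h, (x, a)⟩ : Σ h, X h × A) ∈ I.hist k x'}

/-- `C_k(x)`: the union of the sets `C_k(x, a)` over all actions `a`. -/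
def desc (k : ℕ) {h : ℕ} (x : X h) : Set (X k) :=
  ⋃ a, I.descAct k x a

/-- The sequence-form weight of the (infoset, action) pairs that precede `x`, that is,
`μ_{1:h-1}(x_{h-1}, a_{h-1})`; it is `1` at the first step. -/
def reach (μ : Plan X A) : ∀ h, X h → ℝ
  | 0, _ => 1
  | h + 1, x => reach μ h (I.par h x).1 * μ h (I.par h x).1 (I.par h x).2

/-- The sequence form `μ_{1:h}(x, a)` of a policy. -/
def seqForm (μ : Plan X A) (h : ℕ) (x : X h) (a : A) : ℝ :=
  I.reach μ h x * μ h x a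

/-- The average of the policies `μ 0, …, μ (T - 1)` in sequence form, written in conditional
form. -/
def average (T : ℕ) (μ : ℕ → Plan X A) : Plan X A := fun h x a =>
  (∑ t ∈ Finset.range T, I.seqForm (μ t) h x a) / ∑ t ∈ Finset.range T, I.reach (μ t) h x

/-- The balanced exploration policy for layer `l`: before step `l` it plays actions
proportionally to their number of descendants in layer `l`, and from step `l` on it is
uniform. -/
def balanced [Fintype A] (l : ℕ) : Plan X A := fun h x a =>
  if h < l then ((I.descAct l x a).ncard : ℝ) / ((I.desc l x).ncard : ℝ)
  else 1 / (Fintype.card A : ℝ)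

/-- The sampling policy for layer `l`: the balanced exploration policy of layer `l` up to and
including step `l`, and the policy `μ` afterwards. -/
def explore [Fintype A] (l : ℕ) (μ : Plan X A) : Plan X A := fun h =>
  if h ≤ l then I.balanced l h else μ h

open Classical in
/-- The importance-weighted estimator of the counterfactual loss at step `l`, computed from the
player's own trajectory `(x_0, a_0, r_0, …, x_{H-1}, a_{H-1}, r_{H-1})` in an episode that
she played with the sampling policy for layer `l`. Since steps are numbered from `0`, there are
`H - l` steps from `l` on. -/
def lossEstimator [Fintype A] {H : ℕ} (l : Fin H) (z : ∀ h : Fin H, X h × A × ℝ)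
    (x : X l) (a : A) : ℝ :=
  (if ((z l).1, (z l).2.1) = (x, a) then 1 else 0) / I.seqForm (I.balanced l) l x a *
    ((H : ℝ) - ((l : ℕ) : ℝ) - ∑ h ∈ Finset.Ici l, (z h).2.2)

/-- The policies of Balanced CFR with Hedge and parameter `η`. Here `z t l` is the player's own
trajectory in the episode of round `t` that she plays with the sampling policy for layer `l`.
The initial policy is uniform, and at each infoset `x` of step `h` the update is the Hedge update
with learning rate `η μ^{⋆,h}_{1:h}(x, a)`. -/
def balancedCFR [Fintype A] {H : ℕ} (η : ℝ) (z : ℕ → Fin H → ∀ h : Fin H, X h × A × ℝ) :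
    ℕ → Plan X A
  | 0 => fun _ _ _ => 1 / (Fintype.card A : ℝ)
  | t + 1 => fun h x a =>
      if hh : h < H then
        let w : A → ℝ := fun a' => balancedCFR η z t h x a' *
          Real.exp (-(η * I.seqForm (I.balanced h) h x a' *
            I.lossEstimator ⟨h, hh⟩ (z t ⟨h, hh⟩) x a'))
        w a / ∑ a', w a'
      else balancedCFR η z t h x a

end InfoTree

/-- A two-player zero-sum imperfect-information extensive-form game with horizon `H`: a partially
observable Markov game with tree structure and perfect recall. Only the steps `0, …, H - 1` are
played; the sets `S h`, `X h`, `Y h` for `h ≥ H` play no role and may be empty. -/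
structure TreeGame (H : ℕ) (S X Y : ℕ → Type*) (A B : Type*) [∀ h, Fintype (S h)] where
  H_pos : 0 < H
  /-- emission functions of the max-player and of the min-player -/
  x : ∀ h, S h → X h
  y : ∀ h, S h → Y h
  x_surj : ∀ h, Function.Surjective (x h)
  y_surj : ∀ h, Function.Surjective (y h)
  /-- distribution of the initial state -/
  p0 : S 0 → ℝ
  p0_nonneg : ∀ s, 0 ≤ p0 s
  p0_sum : ∑ s, p0 s = 1
  /-- transition probabilities: `p h s a b s'` stands for `p_h(s' | s, a, b)` -/
  p : ∀ h, S h → A → B → S (h + 1) → ℝ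
  p_nonneg : ∀ h s a b s', 0 ≤ p h s a b s'
  p_sum : ∀ h, h + 1 < H → ∀ s a b, ∑ s', p h s a b s' = 1
  /-- distributions of the random rewards, which are supported in `[0, 1]` -/
  R : ∀ h, S h → A → B → Measure ℝ
  R_prob : ∀ h s a b, IsProbabilityMeasure (R h s a b)
  R_supp : ∀ h s a b, R h s a b (Set.Icc 0 1)ᶜ = 0
  /-- tree structure: each state has a unique predecessor (state, action, action) -/
  par : ∀ h, S (h + 1) → S h × A × B
  par_unique : ∀ h s a b s', p h s a b s' ≠ 0 → par h s' = (s, a, b)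
  /-- perfect recall: each infoset has a unique predecessor (infoset, own action) -/
  xTree : InfoTree X A
  yTree : InfoTree Y B
  x_recall : ∀ h (s : S (h + 1)),
    xTree.par h (x (h + 1) s) = (x h (par h s).1, (par h s).2.1)
  y_recall : ∀ h (s : S (h + 1)),
    yTree.par h (y (h + 1) s) = (y h (par h s).1, (par h s).2.2)

/-- The states and actions of both players in one episode. -/
abbrev GamePath (H : ℕ) (S : ℕ → Type*) (A B : Type*) := ∀ h : Fin H, S h × A × B

namespace TreeGame

variable {H : ℕ} {S X Y : ℕ → Type*} {A B : Type*} [∀ h, Fintype (S h)]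
  (G : TreeGame H S X Y A B)

/-- The probability that an episode played with `μ` and `ν` has the states and actions `d`. -/
def pathProb (μ : Plan X A) (ν : Plan Y B) (d : GamePath H S A B) : ℝ :=
  G.p0 (d ⟨0, G.H_pos⟩).1 *
    (∏ h : Fin H, μ h (G.x h (d h).1) (d h).2.1 * ν h (G.y h (d h).1) (d h).2.2) *
    ∏ h : Fin (H - 1), G.p h (d ⟨h, by omega⟩).1 (d ⟨h, by omega⟩).2.1
      (d ⟨h, by omega⟩).2.2 (d ⟨h + 1, by omega⟩).1

/-- The law of the rewards `(r_0, …, r_{H-1})` given the states and actions `d`. -/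
def rewardLaw (d : GamePath H S A B) : Measure (Fin H → ℝ) :=
  Measure.pi fun h : Fin H => G.R h (d h).1 (d h).2.1 (d h).2.2

/-- The mean reward. -/
def meanReward (h : ℕ) (s : S h) (a : A) (b : B) : ℝ := ∫ r, r ∂(G.R h s a b)

variable [Fintype A] [Fintype B]

/-- The value `V^{μ, ν}`: the expected sum of the rewards of an episode played with
`μ` and `ν`. -/
def value (μ : Plan X A) (ν : Plan Y B) : ℝ :=
  ∑ d : GamePath H S A B, G.pathProb μ ν d *
    ∑ h : Fin H, G.meanReward h (d h).1 (d h).2.1 (d h).2.2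

/-- `NEGap(μ, ν) = max_{μ'} V^{μ', ν} - min_{ν'} V^{μ, ν'}`, over all policies `μ'`, `ν'`. -/
def NEGap (μ : Plan X A) (ν : Plan Y B) : ℝ :=
  (⨆ μ' : {μ' : Plan X A // IsPolicy H μ'}, G.value μ' ν) -
    ⨅ ν' : {ν' : Plan Y B // IsPolicy H ν'}, G.value μ ν'

/-- `(μ, ν)` is a pair of policies that is an `ε`-approximate Nash equilibrium. -/
def IsApproxNash (ε : ℝ) (μ : Plan X A) (ν : Plan Y B) : Prop :=
  IsPolicy H μ ∧ IsPolicy H ν ∧ G.NEGap μ ν ≤ ε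

end TreeGame

/-- The number of the episode of round `t` in which the max-player plays her sampling policy for
layer `l`. A round has `2H` episodes: first `H` of this kind, one for each layer. -/
def maxEpisode (H t l : ℕ) : ℕ := 2 * H * t + l

/-- The number of the episode of round `t` in which the min-player plays her sampling policy for
layer `l`; these are the last `H` of the `2H` episodes of the round. -/
def minEpisode (H t l : ℕ) : ℕ := 2 * H * t + H + l

/-- The total number of episodes played in `T` rounds. -/
def numEpisodes (H T : ℕ) : ℕ := 2 * H * T

namespace TreeGame

variable {H : ℕ} {S X Y : ℕ → Type*} {A B : Type*} [∀ h, Fintype (S h)]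
  (G : TreeGame H S X Y A B) [Fintype A] [Fintype B]

/-- The max-player's policy of round `t` in self-play, computed from the states and actions
`d e` and the rewards `r e` of the episodes `e = 0, 1, …`. Only her own infosets, actions and
rewards in the episodes where she explores are used. -/
def maxPolicy (η : ℝ) (d : ℕ → GamePath H S A B) (r : ℕ → Fin H → ℝ) (t : ℕ) : Plan X A :=
  G.xTree.balancedCFR η
    (fun t (l : Fin H) h => (G.x h (d (maxEpisode H t l) h).1, (d (maxEpisode H t l) h).2.1,
      r (maxEpisode H t l) h)) t

/-- The min-player's policy of round `t` in self-play. She runs the same algorithm on her own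
infosets and actions, with `1 - r` in place of the reward `r`. -/
def minPolicy (η : ℝ) (d : ℕ → GamePath H S A B) (r : ℕ → Fin H → ℝ) (t : ℕ) : Plan Y B :=
  G.yTree.balancedCFR η
    (fun t (l : Fin H) h => (G.y h (d (minEpisode H t l) h).1, (d (minEpisode H t l) h).2.2,
      1 - r (minEpisode H t l) h)) t

/-- The conditional law, given the information `m`, of the states and actions `d` and the rewards
`r` of an episode is that of an episode played with `μ` and `ν`, which may be random. -/
def EpisodeLaw {Ω : Type*} [MeasurableSpace Ω] (P : Measure Ω) (m : MeasurableSpace Ω)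
    (μ : Ω → Plan X A) (ν : Ω → Plan Y B) (d : Ω → GamePath H S A B) (r : Ω → Fin H → ℝ) : Prop :=
  ∀ E : Set Ω, MeasurableSet[m] E → ∀ d₀ : GamePath H S A B, ∀ F : Set (Fin H → ℝ), MeasurableSet F →
    P (E ∩ {ω | d ω = d₀} ∩ {ω | r ω ∈ F}) =
      G.rewardLaw d₀ F * ∫⁻ ω in E, ENNReal.ofReal (G.pathProb (μ ω) (ν ω) d₀) ∂P

/-- `(d e, r e)`, `e < numEpisodes H T`, are the random episodes of `T` rounds of self-play of
Balanced CFR with Hedge, with parameters `ηX` and `ηY`. The σ-algebra `ℱ e` is the information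
available before episode `e`. In round `t` the max-player first plays her `H` sampling policies
against the current policy of the min-player, then the roles are exchanged. -/
structure IsSelfPlay {Ω : Type*} [mΩ : MeasurableSpace Ω] (P : Measure Ω) (ℱ : Filtration ℕ mΩ)
    (ηX ηY : ℝ) (T : ℕ) (d : ℕ → Ω → GamePath H S A B) (r : ℕ → Ω → Fin H → ℝ) : Prop where
  path_measurable : ∀ e < numEpisodes H T, ∀ d₀, MeasurableSet[ℱ (e + 1)] {ω | d e ω = d₀}
  reward_measurable : ∀ e < numEpisodes H T, Measurable[ℱ (e + 1)] (r e)
  max_episode : ∀ t < T, ∀ l < H, G.EpisodeLaw P (ℱ (maxEpisode H t l))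
    (fun ω => G.xTree.explore l (G.maxPolicy ηX (fun e => d e ω) (fun e => r e ω) t))
    (fun ω => G.minPolicy ηY (fun e => d e ω) (fun e => r e ω) t)
    (d (maxEpisode H t l)) (r (maxEpisode H t l))
  min_episode : ∀ t < T, ∀ l < H, G.EpisodeLaw P (ℱ (minEpisode H t l))
    (fun ω => G.maxPolicy ηX (fun e => d e ω) (fun e => r e ω) t)
    (fun ω => G.yTree.explore l (G.minPolicy ηY (fun e => d e ω) (fun e => r e ω) t))
    (d (minEpisode H t l)) (r (minEpisode H t l))

end TreeGame

/-- The number of (infoset, action) pairs in the steps `0, …, H - 1`; this is `XA`, where `X` is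
the total number of infosets and `A` the number of actions. -/
def numPairs (H : ℕ) (X : ℕ → Type*) (A : Type*) [∀ h, Fintype (X h)] [Fintype A] : ℕ :=
  (∑ h ∈ Finset.range H, Fintype.card (X h)) * Fintype.card A

end

-- By perfect recall the value is affine in each player's sequence form, so `T` times the gap of the
-- averaged policies is the sum of the two players' regrets against their best fixed policies; the
-- terms V(μ^t, ν^t) cancel. It suffices to bound the regret of one player against an arbitrary
-- predictable opponent (`IsRun.measure_regret_le`).
--
-- The performance difference formula writes this regret as a sum over infosets of regrets with
-- respect to counterfactual losses, weighted by the comparator's reach probability. The sampling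
-- policy of layer `l` plays the balanced policy up to `l` and the current policy afterwards, so the
-- importance-weighted estimator is unbiased for exactly these losses
-- (`IsKernel.sum_mul_estimator`).
--
-- At an infoset let b be the balanced sequence-form weight and θ = ηH. The Hedge step size ηb
-- cancels the importance weight, so all exponents lie in [0, θ]. Exponential supermartingales
-- compare estimated and true losses, with multiplicative error of order θ and additive error
-- ι/(ηb). With the Hedge bound, the local regret is at most θ times the sum of the two cumulative
-- losses plus 3ι/(ηb). This holds for all infosets and actions at once, hence for all comparators,
-- with no union bound over policies.
--
-- Summing with the comparator's weights, the losses of one layer and one round total at most H, as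
-- they form the expected loss of a single policy. The terms 1/b sum to |X_l|A by the balancing
-- property (`HasChildren.sum_reach_div_balanced`). The regret is therefore at most 2θTH² + 3ιXA/η
-- (`regret_le`), which is 5√(H³T·XA·ι) for the prescribed η.

noncomputable section

/-! ### Infoset trees and the balancing property of the exploration policy. -/

namespace InfoTree

variable {X : ℕ → Type*} {A : Type*} (I : InfoTree X A)

lemma reach_congr {μ μ' : Plan X A} : ∀ {h : ℕ}, (∀ k < h, μ k = μ' k) → ∀ x : X h,
    I.reach μ h x = I.reach μ' h x
  | 0, _, _ => rfl
  | h + 1, hk, x => by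
      rw [reach, reach, reach_congr (fun k hk' => hk k (by omega)), hk h (by omega)]

lemma seqForm_congr {μ μ' : Plan X A} {h : ℕ} (hk : ∀ k ≤ h, μ k = μ' k) (x : X h) (a : A) :
    I.seqForm μ h x a = I.seqForm μ' h x a := by
  rw [seqForm, seqForm, I.reach_congr (fun k hk' => hk k hk'.le), hk h le_rfl]

lemma reach_nonneg [Fintype A] {H : ℕ} {μ : Plan X A} (hμ : IsPolicy H μ) :
    ∀ {h : ℕ}, h ≤ H → ∀ x : X h, 0 ≤ I.reach μ h x
  | 0, _, _ => zero_le_one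
  | h + 1, hh, x => mul_nonneg (reach_nonneg hμ (by omega) _) ((hμ h (by omega) _).1 _)

lemma seqForm_nonneg [Fintype A] {H : ℕ} {μ : Plan X A} (hμ : IsPolicy H μ) {h : ℕ} (hh : h < H)
    (x : X h) (a : A) : 0 ≤ I.seqForm μ h x a :=
  mul_nonneg (I.reach_nonneg hμ hh.le x) ((hμ h hh x).1 a)

lemma reach_pos {H : ℕ} {μ : Plan X A} (hμ : ∀ h < H, ∀ x a, 0 < μ h x a) :
    ∀ {h : ℕ}, h ≤ H → ∀ x : X h, 0 < I.reach μ h x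
  | 0, _, _ => zero_lt_one
  | h + 1, hh, x => mul_pos (reach_pos hμ (by omega) _) (hμ h (by omega) _ _)

lemma sum_seqForm [Fintype A] {H : ℕ} {μ : Plan X A} (hμ : IsPolicy H μ) {h : ℕ} (hh : h < H)
    (x : X h) : ∑ a, I.seqForm μ h x a = I.reach μ h x := by
  simp only [seqForm]
  rw [← Finset.mul_sum, (hμ h hh x).2, mul_one]

/-- The ancestor of an infoset at an earlier step. -/
def ancestor : ∀ l, X l → ∀ h, h ≤ l → X h
  | 0, x, _, hh => (Nat.le_zero.1 hh) ▸ x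
  | l + 1, x, h, hh =>
      if e : h = l + 1 then e ▸ x else ancestor l (I.par l x).1 h (by omega)

lemma ancestor_self : ∀ l (x : X l), I.ancestor l x l le_rfl = x
  | 0, _ => rfl
  | l + 1, x => by simp [ancestor]

lemma ancestor_succ {l : ℕ} (x : X (l + 1)) {h : ℕ} (hh : h ≤ l) :
    I.ancestor (l + 1) x h (by omega) = I.ancestor l (I.par l x).1 h hh := by
  rw [ancestor, dif_neg (by omega)]

lemma par_ancestor : ∀ l (x : X l) h (hh : h < l),
    (I.par h (I.ancestor l x (h + 1) hh)).1 = I.ancestor l x h hh.le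
  | l + 1, x, h, hh => by
      rcases Nat.lt_succ_iff_lt_or_eq.1 hh with h1 | rfl
      · rw [I.ancestor_succ x h1, I.ancestor_succ x h1.le, par_ancestor l _ h h1]
      · rw [I.ancestor_self, I.ancestor_succ x le_rfl, I.ancestor_self]

lemma lt_of_mem_hist : ∀ l (x : X l) {p : Σ h, X h × A}, p ∈ I.hist l x → p.1 < l
  | 0, _, _, hp => by simp [hist] at hp
  | l + 1, x, p, hp => by
      rw [hist, List.mem_cons] at hp
      rcases hp with rfl | hp
      · exact Nat.lt_succ_self l
      · exact (lt_of_mem_hist l _ hp).trans (Nat.lt_succ_self l)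

/-- A history has exactly one entry per earlier step. Reachability thus becomes an equation for a
function of `x`, and the sets `descAct` become its fibres, which can be counted. -/
lemma mem_hist_iff : ∀ l (x : X l) h (hh : h < l) (p : X h × A),
    (⟨h, p⟩ : Σ h, X h × A) ∈ I.hist l x ↔ I.par h (I.ancestor l x (h + 1) hh) = p
  | l + 1, x, h, hh, p => by
      rw [hist, List.mem_cons]
      rcases Nat.lt_succ_iff_lt_or_eq.1 hh with h1 | rfl
      · rw [I.ancestor_succ x h1, mem_hist_iff l _ h h1 p, or_iff_right]
        intro e
        exact absurd (congrArg Sigma.fst e) h1.ne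
      · rw [I.ancestor_self, or_iff_left]
        · constructor
          · intro e
            exact (eq_of_heq (Sigma.mk.inj_iff.1 e).2).symm
          · rintro rfl
            rfl
        · intro hm
          exact lt_irrefl _ (I.lt_of_mem_hist _ _ hm)

/-- Every action at every infoset before the last step leads to some infoset. -/
def HasChildren (H : ℕ) : Prop :=
  ∀ h, h + 1 < H → ∀ (x : X h) (a : A), ∃ x' : X (h + 1), I.par h x' = (x, a)

variable {I}

lemma HasChildren.exists_ancestor [Nonempty A] {H : ℕ} (hI : I.HasChildren H) {h : ℕ} (x : X h) :
    ∀ l (hl : h ≤ l), l < H → ∃ x' : X l, I.ancestor l x' h hl = x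
  | 0, hl, _ => by
      obtain rfl := Nat.le_zero.1 hl
      exact ⟨x, rfl⟩
  | l + 1, hl, hH => by
      rcases Nat.of_le_succ hl with h1 | rfl
      · obtain ⟨x', hx'⟩ := hI.exists_ancestor x l h1 (by omega)
        obtain ⟨x2, h2⟩ := hI l hH x' (Classical.arbitrary A)
        exact ⟨x2, by rw [I.ancestor_succ x2 h1, h2, hx']⟩
      · exact ⟨x, I.ancestor_self _ x⟩

variable [∀ h, Fintype (X h)]

open Classical in
lemma ncard_descAct {l h : ℕ} (hh : h < l) (x : X h) (a : A) :
    (I.descAct l x a).ncard =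
      (Finset.univ.filter fun x' => I.par h (I.ancestor l x' (h + 1) hh) = (x, a)).card := by
  rw [← Set.ncard_coe_finset]
  congr 1
  ext x'
  simp [descAct, I.mem_hist_iff l x' h hh]

open Classical in
lemma ncard_desc {l h : ℕ} (hh : h < l) (x : X h) :
    (I.desc l x).ncard = (Finset.univ.filter fun x' => I.ancestor l x' h hh.le = x).card := by
  rw [← Set.ncard_coe_finset]
  congr 1
  ext x'
  simp only [desc, descAct, I.mem_hist_iff l x' h hh, Set.mem_iUnion, Set.mem_ofPred_eq,
    Finset.coe_filter, Finset.mem_univ, true_and, ← I.par_ancestor l x' h hh]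
  constructor
  · rintro ⟨a, e⟩
    rw [e]
  · intro e
    exact ⟨_, Prod.ext e rfl⟩

lemma HasChildren.ncard_descAct_pos [Nonempty A] {H : ℕ} (hI : I.HasChildren H) {l h : ℕ}
    (hh : h < l) (hl : l < H) (x : X h) (a : A) : 0 < (I.descAct l x a).ncard := by
  classical
  rw [ncard_descAct hh, Finset.card_pos]
  obtain ⟨x1, h1⟩ := hI h (by omega) x a
  obtain ⟨x', h2⟩ := hI.exists_ancestor x1 l hh hl
  exact ⟨x', by simp [h2, h1]⟩

variable [Fintype A]

/-- Perfect recall makes the sets C_l(x, a) disjoint for different `a`: a descendant determines the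
action taken at `x`. -/
lemma sum_ncard_descAct {l h : ℕ} (hh : h < l) (x : X h) :
    ∑ a, (I.descAct l x a).ncard = (I.desc l x).ncard := by
  classical
  rw [ncard_desc hh]
  simp_rw [ncard_descAct hh]
  rw [Finset.card_eq_sum_card_fiberwise (t := Finset.univ)
    (f := fun x' => (I.par h (I.ancestor l x' (h + 1) hh)).2) (fun _ _ => Finset.mem_coe.2 (Finset.mem_univ _))]
  refine Finset.sum_congr rfl fun a _ => ?_
  congr 1
  ext x'
  simp [Prod.ext_iff, I.par_ancestor l x' h hh]

lemma HasChildren.balanced_pos [Nonempty A] {H : ℕ} (hI : I.HasChildren H) {l : ℕ} (hl : l < H)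
    (h : ℕ) (x : X h) (a : A) : 0 < I.balanced l h x a := by
  unfold balanced
  split_ifs with hh
  · have h1 := hI.ncard_descAct_pos hh hl x
    have h2 : 0 < (I.desc l x).ncard := by
      rw [← sum_ncard_descAct hh]
      exact Finset.sum_pos (fun a _ => h1 a) Finset.univ_nonempty
    have := h1 a
    positivity
  · positivity

lemma HasChildren.isPolicy_balanced [Nonempty A] {H : ℕ} (hI : I.HasChildren H) {l : ℕ}
    (hl : l < H) : IsPolicy H (I.balanced l) := by
  intro h _ x
  refine ⟨fun a => (hI.balanced_pos hl h x a).le, ?_⟩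
  unfold balanced
  split_ifs with hh
  · have h1 := hI.ncard_descAct_pos hh hl x
    have h2 : 0 < (I.desc l x).ncard := by
      rw [← sum_ncard_descAct hh]
      exact Finset.sum_pos (fun a _ => h1 a) Finset.univ_nonempty
    rw [← Finset.sum_div, ← Nat.cast_sum, sum_ncard_descAct hh, div_self]
    exact_mod_cast h2.ne'
  · simp

lemma HasChildren.isPolicy_explore [Nonempty A] {H : ℕ} (hI : I.HasChildren H) {l : ℕ}
    (hl : l < H) {μ : Plan X A} (hμ : IsPolicy H μ) : IsPolicy H (I.explore l μ) := by
  intro h hh x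
  unfold explore
  split_ifs with h1
  · exact hI.isPolicy_balanced hl h hh x
  · exact hμ h hh x

/-- The balancing property of the exploration policy. -/
lemma HasChildren.sum_reach_div_balanced [Nonempty A] {H : ℕ} (hI : I.HasChildren H) {l : ℕ}
    (hl : l < H) {μ : Plan X A} (hμ : IsPolicy H μ) :
    ∑ x : X l, I.reach μ l x / I.reach (I.balanced l) l x = Fintype.card (X l) := by
  classical
  -- The sum always runs over layer `l`, but the ratio is evaluated at the ancestors of step `k`.
  -- Its value does not depend on `k`, and at `k = 0` every summand is 1.
  have key : ∀ k (hk : k ≤ l), ∑ x : X l, I.reach μ k (I.ancestor l x k hk) /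
      I.reach (I.balanced l) k (I.ancestor l x k hk) = Fintype.card (X l) := by
    intro k
    induction k with
    | zero => intro hk; simp [reach]
    | succ k ih =>
      intro hk
      rw [← ih (by omega)]
      set f : X k → ℝ := fun x => I.reach μ k x / I.reach (I.balanced l) k x with hf
      set pr : X l → X k × A := fun x => I.par k (I.ancestor l x (k + 1) hk) with hpr
      have e1 : ∀ x : X l, I.reach μ (k + 1) (I.ancestor l x (k + 1) hk) /
          I.reach (I.balanced l) (k + 1) (I.ancestor l x (k + 1) hk) =
          (fun p : X k × A => f p.1 * (μ k p.1 p.2 / I.balanced l k p.1 p.2)) (pr x) := by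
        intro x
        simp only [reach, hf, hpr]
        rw [mul_div_mul_comm]
      rw [Finset.sum_congr rfl fun x _ => e1 x,
        ← Finset.sum_fiberwise' Finset.univ pr
          (fun p : X k × A => f p.1 * (μ k p.1 p.2 / I.balanced l k p.1 p.2)),
        Fintype.sum_prod_type]
      change _ = ∑ x : X l, f (I.ancestor l x k _)
      rw [← Finset.sum_fiberwise' _ (fun x : X l => I.ancestor l x k (by omega)) f]
      refine Finset.sum_congr rfl fun x _ => ?_
      rw [Finset.sum_const, ← ncard_desc hk, nsmul_eq_mul]
      have h2 : 0 < (I.desc l x).ncard := by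
        rw [← sum_ncard_descAct hk]
        exact Finset.sum_pos (fun a _ => hI.ncard_descAct_pos hk hl x a) Finset.univ_nonempty
      -- The fibre over `(x, a)` has |C_l(x, a)| elements, which cancels the numerator of the
      -- balanced probability; then `μ k x` sums to one.
      have e2 : ∀ a, ∑ x' : X l with pr x' = (x, a), f x * (μ k x a / I.balanced l k x a) =
          ((I.desc l x).ncard * f x) * μ k x a := by
        intro a
        rw [Finset.sum_const, ← ncard_descAct hk, nsmul_eq_mul, balanced,
          if_pos (show k < l from hk)]
        have h1 := hI.ncard_descAct_pos hk hl x a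
        have h1' : ((I.descAct l x a).ncard : ℝ) ≠ 0 := by exact_mod_cast h1.ne'
        have h2' : ((I.desc l x).ncard : ℝ) ≠ 0 := by exact_mod_cast h2.ne'
        field_simp
      rw [Finset.sum_congr rfl fun a _ => e2 a, ← Finset.mul_sum, (hμ k (by omega) x).2, mul_one]
  have := key l le_rfl
  simpa only [I.ancestor_self] using this

end InfoTree

/-! ### Regret of Hedge against a fixed action. -/

/-- Invert the quadratic lower bound of exp, using (1 + u + u²/2)(1 − u + u²/2) = 1 + u⁴/4 ≥ 1. -/
lemma exp_neg_le_quadratic {u : ℝ} (hu : 0 ≤ u) : Real.exp (-u) ≤ 1 - u + u ^ 2 / 2 := by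
  have h1 := Real.quadratic_le_exp_of_nonneg hu
  have h2 : 0 < 1 + u + u ^ 2 / 2 := by positivity
  rw [Real.exp_neg]
  refine (inv_anti₀ h2 h1).trans ?_
  rw [inv_le_iff_one_le_mul₀ h2]
  nlinarith [sq_nonneg (u ^ 2)]

/-- One step of the Hedge update increases the log-weight of an action as compared to its loss. -/
lemma hedge_step {A : Type*} [Fintype A] {w Z : A → ℝ} {β θ : ℝ} (hw : ∀ a, 0 < w a)
    (hw1 : ∑ a, w a = 1) (hβ : ∀ a, 0 ≤ β * Z a) (hθ : ∀ a, β * Z a ≤ θ) (a : A) :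
    Real.log (w a) - β * Z a + (1 - θ / 2) * (β * ∑ b, w b * Z b) ≤
      Real.log (w a * Real.exp (-(β * Z a)) / ∑ b, w b * Real.exp (-(β * Z b))) := by
  have hne : (Finset.univ : Finset A).Nonempty := ⟨a, Finset.mem_univ a⟩
  have hN : 0 < ∑ b, w b * Real.exp (-(β * Z b)) :=
    Finset.sum_pos (fun b _ => mul_pos (hw b) (Real.exp_pos _)) hne
  -- Exponents lie in [0, θ], so their squares are at most θ times themselves. The second-order term
  -- is absorbed into the linear one as the factor 1 − θ/2.
  have hb : ∑ b, w b * Real.exp (-(β * Z b)) ≤ 1 - (1 - θ / 2) * (β * ∑ b, w b * Z b) := by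
    have h1 : ∀ b, w b * Real.exp (-(β * Z b)) ≤ w b - (1 - θ / 2) * β * (w b * Z b) := by
      intro b
      have h2 := exp_neg_le_quadratic (hβ b)
      have h3 : (β * Z b) ^ 2 ≤ θ * (β * Z b) := by
        rw [sq]; exact mul_le_mul_of_nonneg_right (hθ b) (hβ b)
      calc w b * Real.exp (-(β * Z b)) ≤ w b * (1 - β * Z b + θ * (β * Z b) / 2) :=
            mul_le_mul_of_nonneg_left (by linarith) (hw b).le
        _ = _ := by ring
    calc _ ≤ ∑ b, (w b - (1 - θ / 2) * β * (w b * Z b)) := Finset.sum_le_sum fun b _ => h1 b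
      _ = _ := by rw [Finset.sum_sub_distrib, hw1, ← Finset.mul_sum]; ring
  rw [Real.log_div (mul_pos (hw a) (Real.exp_pos _)).ne' hN.ne',
    Real.log_mul (hw a).ne' (Real.exp_pos _).ne', Real.log_exp]
  have h4 := Real.log_le_sub_one_of_pos hN
  linarith

/-- The regret of Hedge against a fixed action. -/
lemma hedge_regret {A : Type*} [Fintype A] {w Z : ℕ → A → ℝ} {β θ : ℝ} {T : ℕ}
    (h0 : ∀ a, w 0 a = 1 / (Fintype.card A : ℝ)) (hw : ∀ t a, 0 < w t a)
    (hw1 : ∀ t, ∑ a, w t a = 1)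
    (hstep : ∀ t a, w (t + 1) a =
      w t a * Real.exp (-(β * Z t a)) / ∑ b, w t b * Real.exp (-(β * Z t b)))
    (hβ : ∀ t < T, ∀ a, 0 ≤ β * Z t a) (hθ : ∀ t < T, ∀ a, β * Z t a ≤ θ) (a : A) :
    (1 - θ / 2) * (β * ∑ t ∈ Finset.range T, ∑ b, w t b * Z t b) ≤
      β * ∑ t ∈ Finset.range T, Z t a + Real.log (Fintype.card A) := by
  -- The log-weight of `a` is the potential: it starts at −log A and can never exceed 0.
  have key : ∀ n ≤ T, -Real.log (Fintype.card A) - β * ∑ t ∈ Finset.range n, Z t a +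
      (1 - θ / 2) * (β * ∑ t ∈ Finset.range n, ∑ b, w t b * Z t b) ≤ Real.log (w n a) := by
    intro n
    induction n with
    | zero => intro _; simp [h0]
    | succ n ih =>
      intro hn
      have h1 := ih (by omega)
      have h2 := hedge_step (hw n) (hw1 n) (hβ n hn) (hθ n hn) a
      rw [hstep, Finset.sum_range_succ, Finset.sum_range_succ]
      linarith
  have h1 := key T le_rfl
  have h2 : w T a ≤ 1 := by
    rw [← hw1 T]
    exact Finset.single_le_sum (f := w T) (fun b _ => (hw T b).le) (Finset.mem_univ a)
  have h3 := Real.log_nonpos (hw T a).le h2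
  linarith

/-! ### One player against a kernel: counterfactual losses and the regret decomposition. -/

/-- What one player sees of the paths `d : D` of an episode: her infosets, her actions, and the
law of her gains given the path. -/
structure PlayerView (H : ℕ) (X : ℕ → Type*) (A D : Type*) where
  tree : InfoTree X A
  children : tree.HasChildren H
  info : D → ∀ h : Fin H, X h
  act : D → Fin H → A
  gains : D → Measure (Fin H → ℝ)
  gains_prob : ∀ d, IsProbabilityMeasure (gains d)
  gains_supp : ∀ d, ∀ᵐ g ∂gains d, ∀ h, g h ∈ Set.Icc (0 : ℝ) 1

/-- The policy that follows `π` up to and including step `l` and `μ` afterwards. -/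
def Plan.splice {X : ℕ → Type*} {A : Type*} (l : ℕ) (π μ : Plan X A) : Plan X A :=
  fun h => if h ≤ l then π h else μ h

lemma IsPolicy.splice {H : ℕ} {X : ℕ → Type*} {A : Type*} [Fintype A] {π μ : Plan X A}
    (hπ : IsPolicy H π) (hμ : IsPolicy H μ) (l : ℕ) : IsPolicy H (Plan.splice l π μ) := by
  intro h hh x
  unfold Plan.splice
  split_ifs
  · exact hπ h hh x
  · exact hμ h hh x

namespace PlayerView

variable {H : ℕ} {X : ℕ → Type*} {A D : Type*} (V : PlayerView H X A D)

/-- The product of the player's own action probabilities along a path. -/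
def weight (μ : Plan X A) (d : D) : ℝ := ∏ h : Fin H, μ h (V.info d h) (V.act d h)

/-- The expected gain at step `h` given the path. -/
def meanGain (d : D) (h : Fin H) : ℝ := ∫ g, g h ∂(V.gains d)

/-- The expected loss from step `l` on given the path. -/
def loss (l : Fin H) (d : D) : ℝ := ∑ h ∈ Finset.Ici l, (1 - V.meanGain d h)

lemma integrable_gain (d : D) (h : Fin H) : Integrable (fun g : Fin H → ℝ => g h) (V.gains d) := by
  have := V.gains_prob d
  refine Integrable.of_bound (C := 1) (measurable_pi_apply h).aestronglyMeasurable ?_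
  filter_upwards [V.gains_supp d] with g hg
  rw [Real.norm_eq_abs, abs_le]
  constructor <;> linarith [(hg h).1, (hg h).2]

lemma meanGain_nonneg (d : D) (h : Fin H) : 0 ≤ V.meanGain d h := by
  refine integral_nonneg_of_ae ?_
  filter_upwards [V.gains_supp d] with g hg using (hg h).1

lemma meanGain_le_one (d : D) (h : Fin H) : V.meanGain d h ≤ 1 := by
  have := V.gains_prob d
  have h1 : V.meanGain d h ≤ ∫ _, (1 : ℝ) ∂(V.gains d) := by
    refine integral_mono_ae (V.integrable_gain d h) (integrable_const _) ?_
    filter_upwards [V.gains_supp d] with g hg using (hg h).2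
  simpa using h1

lemma loss_nonneg (l : Fin H) (d : D) : 0 ≤ V.loss l d :=
  Finset.sum_nonneg fun h _ => by linarith [V.meanGain_le_one d h]

lemma loss_le (l : Fin H) (d : D) : V.loss l d ≤ H := by
  calc V.loss l d ≤ ∑ h ∈ Finset.Ici l, (1 : ℝ) :=
        Finset.sum_le_sum fun h _ => by linarith [V.meanGain_nonneg d h]
    _ ≤ ∑ h : Fin H, (1 : ℝ) :=
        Finset.sum_le_sum_of_subset_of_nonneg (Finset.subset_univ _) fun _ _ _ => zero_le_one
    _ = H := by simp

/-- Each infoset on the path `d` is preceded by the infoset and the action before it on `d`. -/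
def Consistent (d : D) : Prop := ∀ h (hh : h + 1 < H), V.tree.par h (V.info d ⟨h + 1, hh⟩) =
  (V.info d ⟨h, by omega⟩, V.act d ⟨h, by omega⟩)

variable {V} in
lemma Consistent.prod_Iic {d : D} (hd : V.Consistent d) (μ : Plan X A) :
    ∀ n (hn : n < H), ∏ h ∈ Finset.Iic (⟨n, hn⟩ : Fin H), μ h (V.info d h) (V.act d h) =
      V.tree.seqForm μ n (V.info d ⟨n, hn⟩) (V.act d ⟨n, hn⟩)
  | 0, hn => by
      have : Finset.Iic (⟨0, hn⟩ : Fin H) = {⟨0, hn⟩} := by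
        ext h; simp [Fin.ext_iff, Fin.le_def]
      rw [this, Finset.prod_singleton, InfoTree.seqForm, InfoTree.reach, one_mul]
  | n + 1, hn => by
      have e : Finset.Iic (⟨n + 1, hn⟩ : Fin H) =
          insert ⟨n + 1, hn⟩ (Finset.Iic (⟨n, by omega⟩ : Fin H)) := by
        ext h; simp only [Finset.mem_Iic, Finset.mem_insert, Fin.ext_iff, Fin.le_def]; omega
      rw [e, Finset.prod_insert (by simp), hd.prod_Iic μ n (by omega), mul_comm]
      have e2 : ∀ (x : X (n + 1)) (a : A), V.tree.seqForm μ (n + 1) x a =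
        V.tree.seqForm μ n (V.tree.par n x).1 (V.tree.par n x).2 * μ (n + 1) x a := fun _ _ => rfl
      exact (congrArg (· * _) (by rw [hd n hn])).trans (e2 _ _).symm

variable {V} in
lemma Consistent.weight_eq {d : D} (hd : V.Consistent d) (μ : Plan X A) (l : Fin H) :
    V.weight μ d = V.tree.seqForm μ l (V.info d l) (V.act d l) *
      ∏ h ∈ Finset.Ioi l, μ h (V.info d h) (V.act d h) := by
  rw [← hd.prod_Iic μ l l.2, weight, ← Finset.prod_union]
  · congr 1
    ext h
    simp [le_or_gt]
  · rw [Finset.disjoint_left]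
    intro h h1 h2
    exact not_lt_of_ge (Finset.mem_Iic.1 h1) (Finset.mem_Ioi.1 h2)

variable [Fintype A]

lemma weight_nonneg {μ : Plan X A} (hμ : IsPolicy H μ) (d : D) : 0 ≤ V.weight μ d :=
  Finset.prod_nonneg fun h _ => (hμ h h.2 _).1 _

variable [Fintype D]

/-- `κ d` is the probability that the environment and the opponent contribute to the path `d`. -/
structure IsKernel (κ : D → ℝ) : Prop where
  nonneg : ∀ d, 0 ≤ κ d
  perfect_recall : ∀ d, κ d ≠ 0 → V.Consistent d
  sum_eq_one : ∀ μ, IsPolicy H μ → ∑ d, κ d * V.weight μ d = 1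
  -- Play after step `j` does not affect the expected gain of step `j`. This is what lets values be
  -- compared through the losses from a given step on.
  causal : ∀ μ μ', IsPolicy H μ → IsPolicy H μ' → ∀ j : Fin H, (∀ h ≤ (j : ℕ), μ h = μ' h) →
    ∑ d, κ d * V.weight μ d * V.meanGain d j = ∑ d, κ d * V.weight μ' d * V.meanGain d j

/-- The expected sum of gains. -/
def value (κ : D → ℝ) (μ : Plan X A) : ℝ :=
  ∑ d, κ d * V.weight μ d * ∑ h, V.meanGain d h

open Classical in
/-- The counterfactual loss of an action at an infoset of step `l`, if `μ` is played from step
`l + 1` on. -/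
def cfLoss (κ : D → ℝ) (μ : Plan X A) (l : Fin H) (x : X l) (a : A) : ℝ :=
  ∑ d, if (V.info d l, V.act d l) = (x, a) then
    κ d * (∏ h ∈ Finset.Ioi l, μ h (V.info d h) (V.act d h)) * V.loss l d else 0

variable {V} {κ : D → ℝ}

lemma IsKernel.weight_splice (hκ : V.IsKernel κ) (π μ : Plan X A) {d : D} (hd : κ d ≠ 0)
    (l : Fin H) : V.weight (Plan.splice l π μ) d = V.tree.seqForm π l (V.info d l) (V.act d l) *
      ∏ h ∈ Finset.Ioi l, μ h (V.info d h) (V.act d h) := by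
  rw [(hκ.perfect_recall d hd).weight_eq _ l]
  congr 1
  · refine V.tree.seqForm_congr (fun k hk => ?_) _ _
    simp [Plan.splice, hk]
  · refine Finset.prod_congr rfl fun h hh => ?_
    have hlt : l < h := Finset.mem_Ioi.1 hh
    have : ¬ (h : ℕ) ≤ l := not_le_of_gt hlt
    simp [Plan.splice, this]

lemma IsKernel.cfLoss_nonneg (hκ : V.IsKernel κ) {μ : Plan X A} (hμ : IsPolicy H μ) (l : Fin H)
    (x : X l) (a : A) : 0 ≤ V.cfLoss κ μ l x a := by
  refine Finset.sum_nonneg fun d _ => ?_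
  split_ifs
  · exact mul_nonneg (mul_nonneg (hκ.nonneg d)
      (Finset.prod_nonneg fun h _ => (hμ h h.2 _).1 _)) (V.loss_nonneg l d)
  · exact le_rfl

-- On consistent paths through `(x, a)` the player's weight up to step `l` is the constant `seqForm
-- π l x a`, so it moves into the sum. With the comparator as `π` this serves the regret
-- decomposition, with the balanced policy the unbiasedness of the estimator.
open Classical in
lemma IsKernel.seqForm_mul_cfLoss (hκ : V.IsKernel κ) (π μ : Plan X A) (l : Fin H)
    (x : X l) (a : A) : V.tree.seqForm π l x a * V.cfLoss κ μ l x a =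
      ∑ d, if (V.info d l, V.act d l) = (x, a) then
        κ d * V.weight (Plan.splice l π μ) d * V.loss l d else 0 := by
  rw [cfLoss, Finset.mul_sum]
  refine Finset.sum_congr rfl fun d _ => ?_
  split_ifs with h
  · by_cases hd : κ d = 0
    · simp [hd]
    · obtain ⟨h1, h2⟩ := Prod.mk.inj h
      rw [hκ.weight_splice π μ hd, h1, h2]
      ring
  · rw [mul_zero]

/-- If two policies agree before step `l`, then the difference of their values is that of their
losses from step `l` on. -/
lemma IsKernel.value_sub_value (hκ : V.IsKernel κ) {μ μ' : Plan X A} (hμ : IsPolicy H μ)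
    (hμ' : IsPolicy H μ') (l : Fin H) (hl : ∀ h < (l : ℕ), μ h = μ' h) :
    V.value κ μ' - V.value κ μ =
      ∑ d, κ d * V.weight μ d * V.loss l d - ∑ d, κ d * V.weight μ' d * V.loss l d := by
  -- Loss from `l` on equals the number of remaining steps plus the gains before `l` minus the
  -- value. The first two terms agree for `μ` and `μ'`, the gains by causality.
  have key : ∀ π : Plan X A, IsPolicy H π → ∑ d, κ d * V.weight π d * V.loss l d =
      ((Finset.Ici l).card : ℝ) +
        ∑ h ∈ Finset.Iio l, (∑ d, κ d * V.weight π d * V.meanGain d h) - V.value κ π := by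
    intro π hπ
    rw [Finset.sum_comm, value, ← mul_one ((Finset.Ici l).card : ℝ), ← hκ.sum_eq_one π hπ,
      Finset.mul_sum, ← Finset.sum_add_distrib, ← Finset.sum_sub_distrib]
    refine Finset.sum_congr rfl fun d _ => ?_
    rw [← Finset.mul_sum]
    have e : ∑ h, V.meanGain d h =
        ∑ h ∈ Finset.Iio l, V.meanGain d h + ∑ h ∈ Finset.Ici l, V.meanGain d h := by
      rw [← Finset.sum_union]
      · congr 1
        ext h
        simp [lt_or_ge]
      · rw [Finset.disjoint_left]
        intro h h1 h2
        exact not_lt_of_ge (Finset.mem_Ici.1 h2) (Finset.mem_Iio.1 h1)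
    rw [e, loss, Finset.sum_sub_distrib, Finset.sum_const, nsmul_eq_mul]
    ring
  rw [key μ hμ, key μ' hμ', Finset.sum_congr rfl fun h hh => hκ.causal μ μ' hμ hμ' h
    fun k hk => hl k (lt_of_le_of_lt hk (show h < l from Finset.mem_Iio.1 hh))]
  ring

variable [∀ h, Fintype (X h)]

lemma IsKernel.sum_seqForm_mul_cfLoss (hκ : V.IsKernel κ) (π μ : Plan X A) (l : Fin H) :
    ∑ x, ∑ a, V.tree.seqForm π l x a * V.cfLoss κ μ l x a =
      ∑ d, κ d * V.weight (Plan.splice l π μ) d * V.loss l d := by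
  classical
  simp_rw [hκ.seqForm_mul_cfLoss π μ l]
  rw [← Fintype.sum_prod_type' (f := fun x a => ∑ d, if (V.info d l, V.act d l) = (x, a) then
        κ d * V.weight (Plan.splice l π μ) d * V.loss l d else 0), Finset.sum_comm]
  refine Finset.sum_congr rfl fun d _ => ?_
  rw [Finset.sum_ite_eq]
  simp

/-- The whole layer adds up to the expected loss of the single spliced policy. Hence the bound does
not grow with the number of infosets. -/
lemma IsKernel.sum_seqForm_mul_cfLoss_le (hκ : V.IsKernel κ) {π μ : Plan X A}
    (hπ : IsPolicy H π) (hμ : IsPolicy H μ) (l : Fin H) :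
    ∑ x, ∑ a, V.tree.seqForm π l x a * V.cfLoss κ μ l x a ≤ H := by
  rw [hκ.sum_seqForm_mul_cfLoss π μ l]
  have h1 := hπ.splice hμ l
  calc _ ≤ ∑ d, κ d * V.weight (Plan.splice l π μ) d * H := Finset.sum_le_sum fun d _ =>
        mul_le_mul_of_nonneg_left (V.loss_le l d)
          (mul_nonneg (hκ.nonneg d) (V.weight_nonneg h1 d))
    _ = H := by rw [← Finset.sum_mul, hκ.sum_eq_one _ h1, one_mul]

/-- The performance difference formula. -/
lemma IsKernel.performance_difference (hκ : V.IsKernel κ) {μ μ' : Plan X A} (hμ : IsPolicy H μ)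
    (hμ' : IsPolicy H μ') : V.value κ μ' - V.value κ μ =
      ∑ l : Fin H, ∑ x, (V.tree.reach μ' l x * ∑ a, μ l x a * V.cfLoss κ μ l x a -
        ∑ a, V.tree.seqForm μ' l x a * V.cfLoss κ μ l x a) := by
  -- The difference of values telescopes along hybrids that play `μ'` before step `k` and `μ` from
  -- `k` on. Consecutive ones differ at one step only.
  set hyb : ℕ → Plan X A := fun k h => if h < k then μ' h else μ h with hhyb
  have hpol : ∀ k, IsPolicy H (hyb k) := by
    intro k h hh x
    simp only [hhyb]
    split_ifs
    · exact hμ' h hh x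
    · exact hμ h hh x
  have h0 : hyb 0 = μ := by ext; simp [hhyb]
  -- These plans may still differ at steps `≥ H`, which no path visits.
  have hH : V.value κ (hyb H) = V.value κ μ' := by
    unfold value weight
    simp [hhyb]
  rw [← hH, ← congrArg (V.value κ) h0, ← Finset.sum_range_sub (fun k => V.value κ (hyb k)),
    ← Fin.sum_univ_eq_sum_range (fun k => V.value κ (hyb (k + 1)) - V.value κ (hyb k))]
  refine Finset.sum_congr rfl fun l _ => ?_
  rw [hκ.value_sub_value (hpol l) (hpol (l + 1)) l]
  · have e1 : hyb (l + 1) = Plan.splice l μ' μ := by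
      ext h x a; simp [hhyb, Plan.splice]
    -- Both neighbouring hybrids follow `μ` after step `l`, so both losses are expressed through the
    -- same `cfLoss κ μ l`.
    have e2 : hyb l = Plan.splice l (hyb l) μ := by
      ext h x a
      simp only [hhyb, Plan.splice]
      split_ifs with h1 h2 h2
      · rfl
      · omega
      · rfl
      · rfl
    rw [e1, ← hκ.sum_seqForm_mul_cfLoss, e2, ← hκ.sum_seqForm_mul_cfLoss,
      ← Finset.sum_sub_distrib]
    refine Finset.sum_congr rfl fun x _ => ?_
    congr 1
    rw [Finset.mul_sum]
    refine Finset.sum_congr rfl fun a _ => ?_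
    rw [InfoTree.seqForm, V.tree.reach_congr (μ' := μ') (fun k hk => by simp [hhyb, hk])]
    simp [hhyb, mul_assoc]
  · intro h hh
    simp [hhyb, hh, Nat.lt_succ_of_lt hh]

/-- From regret bounds at all infosets to a bound for the regret. -/
theorem regret_le [Nonempty A] {T : ℕ} {κ : ℕ → D → ℝ} {μ : ℕ → Plan X A}
    (hκ : ∀ t < T, V.IsKernel (κ t)) (hμ : ∀ t < T, IsPolicy H (μ t)) {θ c : ℝ} (hθ : 0 ≤ θ)
    (hreg : ∀ (l : Fin H) (x : X l) (a : A),
      ∑ t ∈ Finset.range T, ∑ b, μ t l x b * V.cfLoss (κ t) (μ t) l x b -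
          ∑ t ∈ Finset.range T, V.cfLoss (κ t) (μ t) l x a ≤
        θ * (∑ t ∈ Finset.range T, ∑ b, μ t l x b * V.cfLoss (κ t) (μ t) l x b +
          ∑ t ∈ Finset.range T, V.cfLoss (κ t) (μ t) l x a) +
        c * (Fintype.card A / V.tree.reach (V.tree.balanced l) l x))
    {μ' : Plan X A} (hμ' : IsPolicy H μ') :
    ∑ t ∈ Finset.range T, (V.value (κ t) μ' - V.value (κ t) (μ t)) ≤
      2 * θ * (T * (H : ℝ) ^ 2) + c * numPairs H X A := by
  set F : ∀ l : Fin H, ℕ → X l → ℝ := fun l t x =>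
    ∑ b, μ t l x b * V.cfLoss (κ t) (μ t) l x b with hF
  have hreg' : ∀ (l : Fin H) (x : X l) (a : A),
      ∑ t ∈ Finset.range T, F l t x - ∑ t ∈ Finset.range T, V.cfLoss (κ t) (μ t) l x a ≤
        θ * (∑ t ∈ Finset.range T, F l t x +
          ∑ t ∈ Finset.range T, V.cfLoss (κ t) (μ t) l x a) +
        c * (Fintype.card A / V.tree.reach (V.tree.balanced l) l x) := hreg
  have hsum : ∀ (l : Fin H) (x : X l) (c : ℝ),
      ∑ a, V.tree.seqForm μ' l x a * c = V.tree.reach μ' l x * c := fun l x c => by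
    rw [← Finset.sum_mul, V.tree.sum_seqForm hμ' l.2]
  -- Reach of `μ'` times the current action probability is the sequence form of the policy that
  -- switches from `μ'` to `μ t` at step `l`.
  have hb1 : ∀ (l : Fin H), ∀ t < T, ∑ x, V.tree.reach μ' l x * F l t x ≤ H := by
    intro l t ht
    refine le_trans (le_of_eq ?_)
      ((hκ t ht).sum_seqForm_mul_cfLoss_le (π := fun h => if h < l then μ' h else μ t h)
        ?_ (hμ t ht) l)
    · refine Finset.sum_congr rfl fun x _ => ?_
      rw [hF, Finset.mul_sum]
      refine Finset.sum_congr rfl fun a _ => ?_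
      rw [InfoTree.seqForm, V.tree.reach_congr (μ := fun h => if h < l then μ' h else μ t h)
        (μ' := μ') (fun k hk => by simp [hk])]
      simp [mul_assoc]
    · intro h hh x
      dsimp only
      split_ifs
      · exact hμ' h hh x
      · exact hμ t ht h hh x
  have hb2 : ∀ (l : Fin H), ∀ t < T,
      ∑ x, ∑ a, V.tree.seqForm μ' l x a * V.cfLoss (κ t) (μ t) l x a ≤ H := fun l t ht =>
    (hκ t ht).sum_seqForm_mul_cfLoss_le hμ' (hμ t ht) l
  have hlayer : ∀ l : Fin H, ∑ t ∈ Finset.range T, ∑ x, (V.tree.reach μ' l x * F l t x -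
        ∑ a, V.tree.seqForm μ' l x a * V.cfLoss (κ t) (μ t) l x a) ≤
      2 * θ * (T * H) + c * (Fintype.card (X l) * Fintype.card A) := by
    intro l
    have h1 := Finset.sum_le_sum fun (x : X l) (_ : x ∈ Finset.univ) =>
      Finset.sum_le_sum fun (a : A) (_ : a ∈ Finset.univ) =>
        mul_le_mul_of_nonneg_left (hreg' l x a) (V.tree.seqForm_nonneg hμ' l.2 x a)
    have e1 : ∀ x : X l, ∑ a, V.tree.seqForm μ' l x a * (∑ t ∈ Finset.range T, F l t x) =
        ∑ t ∈ Finset.range T, V.tree.reach μ' l x * F l t x := fun x => by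
      rw [hsum, Finset.mul_sum]
    have e2 : ∀ x : X l, ∑ a, V.tree.seqForm μ' l x a *
          ∑ t ∈ Finset.range T, V.cfLoss (κ t) (μ t) l x a =
        ∑ t ∈ Finset.range T, ∑ a, V.tree.seqForm μ' l x a * V.cfLoss (κ t) (μ t) l x a :=
      fun x => by
        simp_rw [Finset.mul_sum]
        rw [Finset.sum_comm]
    -- The balancing property: whatever the comparator, the inverse exploration weights sum to the
    -- number of infosets of the layer.
    have e3 : ∑ x, ∑ a, V.tree.seqForm μ' l x a *
          (c * (Fintype.card A / V.tree.reach (V.tree.balanced l) l x)) =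
        c * (Fintype.card (X l) * Fintype.card A) := by
      simp_rw [hsum]
      rw [← V.children.sum_reach_div_balanced l.2 hμ', Finset.sum_mul, Finset.mul_sum]
      refine Finset.sum_congr rfl fun x _ => by ring
    have s1 : ∑ x, ∑ t ∈ Finset.range T, V.tree.reach μ' l x * F l t x ≤ T * H := by
      rw [Finset.sum_comm]
      calc _ ≤ ∑ t ∈ Finset.range T, (H : ℝ) :=
            Finset.sum_le_sum fun t ht => hb1 l t (Finset.mem_range.1 ht)
        _ = T * H := by simp
    have s2 : ∑ x, ∑ t ∈ Finset.range T,
        ∑ a, V.tree.seqForm μ' l x a * V.cfLoss (κ t) (μ t) l x a ≤ T * H := by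
      rw [Finset.sum_comm]
      calc _ ≤ ∑ t ∈ Finset.range T, (H : ℝ) :=
            Finset.sum_le_sum fun t ht => hb2 l t (Finset.mem_range.1 ht)
        _ = T * H := by simp
    have h2 : ∑ x, (∑ a, V.tree.seqForm μ' l x a * (∑ t ∈ Finset.range T, F l t x) -
          ∑ a, V.tree.seqForm μ' l x a * ∑ t ∈ Finset.range T, V.cfLoss (κ t) (μ t) l x a) ≤
        θ * (∑ x, (∑ a, V.tree.seqForm μ' l x a * (∑ t ∈ Finset.range T, F l t x)) +
          ∑ x, ∑ a, V.tree.seqForm μ' l x a *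
            ∑ t ∈ Finset.range T, V.cfLoss (κ t) (μ t) l x a) +
        ∑ x, ∑ a, V.tree.seqForm μ' l x a *
          (c * (Fintype.card A / V.tree.reach (V.tree.balanced l) l x)) := by
      refine le_trans (le_of_eq ?_) (h1.trans (le_of_eq ?_))
      · simp_rw [mul_sub, Finset.sum_sub_distrib]
      · simp_rw [mul_add, Finset.sum_add_distrib, mul_left_comm _ θ, ← Finset.mul_sum]
    rw [e3] at h2
    simp_rw [e1, e2] at h2
    rw [Finset.sum_comm]
    simp_rw [Finset.sum_sub_distrib] at h2 ⊢
    nlinarith [mul_le_mul_of_nonneg_left (add_le_add s1 s2) hθ]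
  calc _ = ∑ l : Fin H, ∑ t ∈ Finset.range T, ∑ x, (V.tree.reach μ' l x * F l t x -
        ∑ a, V.tree.seqForm μ' l x a * V.cfLoss (κ t) (μ t) l x a) := by
        rw [Finset.sum_comm]
        exact Finset.sum_congr rfl fun t ht =>
          (hκ t (Finset.mem_range.1 ht)).performance_difference (hμ t (Finset.mem_range.1 ht)) hμ'
    _ ≤ ∑ l : Fin H, (2 * θ * (T * H) + c * (Fintype.card (X l) * Fintype.card A)) :=
        Finset.sum_le_sum fun l _ => hlayer l
    _ = _ := by
        simp only [Finset.sum_add_distrib, ← Finset.mul_sum, ← Finset.sum_mul, Finset.sum_const]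
        rw [Fin.sum_univ_eq_sum_range (fun l => (Fintype.card (X l) : ℝ)) H, numPairs]
        push_cast
        simp only [Finset.card_univ, Fintype.card_fin, nsmul_eq_mul]
        ring

end PlayerView

/-! ### Exponential inequalities and supermartingale concentration. -/

lemma exp_mul_le_of_mem_Icc {w u : ℝ} (h0 : 0 ≤ w) (h1 : w ≤ 1) :
    Real.exp (w * u) ≤ (1 - w) + w * Real.exp u := by
  have := convexOn_exp.2 (Set.mem_univ 0) (Set.mem_univ u) (sub_nonneg.2 h1) h0 (by ring)
  simpa using this

lemma exp_sub_one_le {θ : ℝ} (h0 : 0 ≤ θ) (h1 : θ ≤ 1) : Real.exp θ - 1 ≤ θ * (1 + θ) := by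
  have := (abs_le.1 (Real.abs_exp_sub_one_sub_id_le (abs_le.2 ⟨by linarith, h1⟩))).2
  linarith [sq θ]

lemma one_sub_exp_neg_ge {θ : ℝ} (h0 : 0 ≤ θ) : θ * (1 - θ / 2) ≤ 1 - Real.exp (-θ) := by
  linarith [exp_neg_le_quadratic h0, sq θ]

section

variable {Ω : Type*} {m : MeasurableSpace Ω} [mΩ : MeasurableSpace Ω] {P : Measure Ω}

/-- An exponential supermartingale bound. -/
lemma measure_sum_ge_le [IsProbabilityMeasure P] {T : ℕ} {m : ℕ → MeasurableSpace Ω} {U : ℕ → Ω → ℝ} (hUm : ∀ t < T, ∀ s < t, Measurable[m t] (U s))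
    (hU : ∀ t < T, Measurable (U t))
    (hstep : ∀ t < T, ∀ f : Ω → ENNReal, Measurable[m t] f →
      ∫⁻ ω, f ω * ENNReal.ofReal (Real.exp (U t ω)) ∂P ≤ ∫⁻ ω, f ω ∂P) (c : ℝ) :
    P {ω | c ≤ ∑ t ∈ Finset.range T, U t ω} ≤ ENNReal.ofReal (Real.exp (-c)) := by
  -- Testing `hstep` against all `m t`-measurable `f` replaces conditional expectations. Here `f` is
  -- the exponential of the sum of the earlier terms, so the expectation stays at most 1; Markov's
  -- inequality concludes.
  have key : ∀ n ≤ T,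
      ∫⁻ ω, ENNReal.ofReal (Real.exp (∑ t ∈ Finset.range n, U t ω)) ∂P ≤ 1 := by
    intro n
    induction n with
    | zero => intro _; simp
    | succ n ih =>
      intro hn
      refine le_trans (le_of_eq ?_) ((hstep n hn
        (fun ω => ENNReal.ofReal (Real.exp (∑ t ∈ Finset.range n, U t ω))) ?_).trans
        (ih (by omega)))
      · refine lintegral_congr fun ω => ?_
        rw [Finset.sum_range_succ, Real.exp_add, ENNReal.ofReal_mul (Real.exp_pos _).le]
      · refine ENNReal.measurable_ofReal.comp (Real.measurable_exp.comp ?_)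
        exact Finset.measurable_fun_sum _ fun s hs => hUm n hn s (Finset.mem_range.1 hs)
  have hmeas : Measurable fun ω => ENNReal.ofReal (Real.exp (∑ t ∈ Finset.range T, U t ω)) := by
    refine ENNReal.measurable_ofReal.comp (Real.measurable_exp.comp ?_)
    exact Finset.measurable_fun_sum _ fun s hs => hU s (Finset.mem_range.1 hs)
  have h1 := mul_meas_ge_le_lintegral (μ := P) hmeas (ENNReal.ofReal (Real.exp c))
  have h2 : {ω | c ≤ ∑ t ∈ Finset.range T, U t ω} ⊆ {ω | ENNReal.ofReal (Real.exp c) ≤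
      ENNReal.ofReal (Real.exp (∑ t ∈ Finset.range T, U t ω))} := fun ω hω =>
    ENNReal.ofReal_le_ofReal (Real.exp_le_exp.2 hω)
  have h3 := (mul_le_mul_right (measure_mono h2 (μ := P))
    (ENNReal.ofReal (Real.exp c))).trans (h1.trans (key T le_rfl))
  have h4 : ENNReal.ofReal (Real.exp (-c)) * ENNReal.ofReal (Real.exp c) = 1 := by
    rw [← ENNReal.ofReal_mul (Real.exp_pos _).le, ← Real.exp_add]
    simp
  calc P {ω | c ≤ ∑ t ∈ Finset.range T, U t ω}
      = ENNReal.ofReal (Real.exp (-c)) * (ENNReal.ofReal (Real.exp c) *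
        P {ω | c ≤ ∑ t ∈ Finset.range T, U t ω}) := by rw [← mul_assoc, h4, one_mul]
    _ ≤ ENNReal.ofReal (Real.exp (-c)) * 1 := mul_le_mul_right h3 _
    _ = _ := mul_one _

/-- If, given `m`, the event `S` has probability `q` and `g` has law `ρ` on it, then integrals of
products factorize. -/
lemma setLIntegral_mul_of_law {R : Type*} [MeasurableSpace R]
    (hm : m ≤ mΩ) {S : Set Ω} {g : Ω → R} (hg : Measurable g)
    {ρ : Measure R} {q : Ω → ENNReal} (hq : Measurable[m] q)
    (hlaw : ∀ E, MeasurableSet[m] E → ∀ F, MeasurableSet F →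
      P (E ∩ S ∩ {ω | g ω ∈ F}) = ρ F * ∫⁻ ω in E, q ω ∂P)
    {f : Ω → ENNReal} (hf : Measurable[m] f) {k : R → ENNReal} (hk : Measurable k) :
    ∫⁻ ω in S, f ω * k (g ω) ∂P = (∫⁻ r, k r ∂ρ) * ∫⁻ ω, f ω * q ω ∂P := by
  have h1 : ∀ E, MeasurableSet[m] E → ∫⁻ ω in E ∩ S, k (g ω) ∂P =
      (∫⁻ r, k r ∂ρ) * ∫⁻ ω in E, q ω ∂P := by
    intro E hE
    -- On `E ∩ S` the law of `g` is a multiple of `ρ`, by `hlaw` on each measurable set.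
    have e : (P.restrict (E ∩ S)).map g = (∫⁻ ω in E, q ω ∂P) • ρ := by
      ext F hF
      rw [Measure.map_apply hg hF, Measure.restrict_apply (hg hF), Set.inter_comm,
        Measure.smul_apply, smul_eq_mul, mul_comm]
      exact hlaw E hE F hF
    rw [← lintegral_map hk hg, e, lintegral_smul_measure, smul_eq_mul, mul_comm]
  -- The two weighted measures need only agree on `m`, since `f` is `m`-measurable.
  have e2 : ((P.restrict S).withDensity fun ω => k (g ω)).trim hm =
      ((∫⁻ r, k r ∂ρ) • P.withDensity q).trim hm := by
    refine @Measure.ext _ m _ _ fun E hE => ?_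
    rw [trim_measurableSet_eq hm hE, trim_measurableSet_eq hm hE, withDensity_apply _ (hm _ hE),
      Measure.restrict_restrict (hm _ hE), h1 E hE, Measure.smul_apply,
      withDensity_apply _ (hm _ hE), smul_eq_mul]
  have hf' : Measurable f := hf.mono hm le_rfl
  have hq' : Measurable q := hq.mono hm le_rfl
  calc ∫⁻ ω in S, f ω * k (g ω) ∂P
      = ∫⁻ ω, f ω ∂((P.restrict S).withDensity fun ω => k (g ω)) := by
        have hkg : Measurable fun ω => k (g ω) := hk.comp hg
        rw [lintegral_withDensity_eq_lintegral_mul _ hkg hf']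
        exact lintegral_congr fun ω => mul_comm _ _
    _ = ∫⁻ ω, f ω ∂((∫⁻ r, k r ∂ρ) • P.withDensity q) := by
        rw [← lintegral_trim hm hf, e2, lintegral_trim hm hf]
    _ = _ := by
        rw [lintegral_smul_measure, lintegral_withDensity_eq_lintegral_mul _ hq' hf', smul_eq_mul]
        congr 1
        exact lintegral_congr fun ω => mul_comm _ _

/-- One step of the exponential supermartingale. Given `m`, the discrete variable `d` has the
distribution `q`, and `g` has the law `ρ d₀` on `{d = d₀}`. -/
lemma lintegral_mul_exp_le {R D : Type*} [MeasurableSpace R] [Fintype D]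
    (hm : m ≤ mΩ) {d : Ω → D} (hd : ∀ d₀, MeasurableSet {ω | d ω = d₀})
    {g : Ω → R} (hg : Measurable g) {ρ : D → Measure R} [∀ d₀, IsProbabilityMeasure (ρ d₀)]
    {q : Ω → D → ℝ} (hq : ∀ d₀, Measurable[m] fun ω => q ω d₀) (hq0 : ∀ ω d₀, 0 ≤ q ω d₀)
    (hq1 : ∀ ω, ∑ d₀, q ω d₀ = 1)
    (hlaw : ∀ E, MeasurableSet[m] E → ∀ d₀, ∀ F, MeasurableSet F →
      P (E ∩ {ω | d ω = d₀} ∩ {ω | g ω ∈ F}) =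
        ρ d₀ F * ∫⁻ ω in E, ENNReal.ofReal (q ω d₀) ∂P)
    {w : Ω → D → ℝ} (hw : ∀ d₀, Measurable[m] fun ω => w ω d₀) (hw0 : ∀ ω d₀, 0 ≤ w ω d₀)
    (hw1 : ∀ ω d₀, w ω d₀ ≤ 1) {ζ : D → R → ℝ} (hζ : ∀ d₀, Measurable (ζ d₀)) {z : D → ℝ}
    {c : ℝ} (hc : ∀ d₀, 0 ≤ 1 + c * z d₀)
    (hexp : ∀ d₀, ∫⁻ r, ENNReal.ofReal (Real.exp (ζ d₀ r)) ∂(ρ d₀) ≤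
      ENNReal.ofReal (1 + c * z d₀))
    {f : Ω → ENNReal} (hf : Measurable[m] f) :
    ∫⁻ ω, f ω * ENNReal.ofReal (Real.exp (w ω (d ω) * ζ (d ω) (g ω) -
      c * ∑ d₀, q ω d₀ * (w ω d₀ * z d₀))) ∂P ≤ ∫⁻ ω, f ω ∂P := by
  set L : Ω → ℝ := fun ω => ∑ d₀, q ω d₀ * (w ω d₀ * z d₀) with hL
  have hLm : Measurable[m] L :=
    Finset.measurable_fun_sum _ fun d₀ _ => (hq d₀).mul ((hw d₀).mul_const _)
  -- The predictable compensator is absorbed into the test function; at the end 1 + cL ≤ exp(cL)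
  -- cancels it.
  set f' : Ω → ENNReal := fun ω => f ω * ENNReal.ofReal (Real.exp (-(c * L ω))) with hf'
  have hf'm : Measurable[m] f' := hf.mul
    (ENNReal.measurable_ofReal.comp (Real.measurable_exp.comp (hLm.const_mul c).neg))
  have hqm : ∀ d₀, Measurable[m] fun ω => ENNReal.ofReal (q ω d₀) := fun d₀ =>
    ENNReal.measurable_ofReal.comp (hq d₀)
  have hA : ∀ d₀, Measurable[m] fun ω => f' ω * ENNReal.ofReal (1 - w ω d₀) := fun d₀ =>
    hf'm.mul (ENNReal.measurable_ofReal.comp ((measurable_const (a := (1 : ℝ))).sub (hw d₀)))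
  have hB : ∀ d₀, Measurable[m] fun ω => f' ω * ENNReal.ofReal (w ω d₀) := fun d₀ =>
    hf'm.mul (ENNReal.measurable_ofReal.comp (hw d₀))
  have hk : ∀ d₀, Measurable fun r => ENNReal.ofReal (Real.exp (ζ d₀ r)) := fun d₀ =>
    ENNReal.measurable_ofReal.comp (Real.measurable_exp.comp (hζ d₀))
  -- On each path event, exp(wζ) ≤ (1 − w) + w exp(ζ) makes the integrand a sum of products of an
  -- `m`-measurable factor and a function of `g`, to which `setLIntegral_mul_of_law` applies.
  have hpart : ∀ d₀, ∫⁻ ω in {ω | d ω = d₀}, f ω * ENNReal.ofReal (Real.exp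
      (w ω (d ω) * ζ (d ω) (g ω) - c * L ω)) ∂P ≤
      ∫⁻ ω, f' ω * ENNReal.ofReal (q ω d₀ * (1 + c * (w ω d₀ * z d₀))) ∂P := by
    intro d₀
    have h1 : ∫⁻ ω in {ω | d ω = d₀}, f ω * ENNReal.ofReal (Real.exp
        (w ω (d ω) * ζ (d ω) (g ω) - c * L ω)) ∂P ≤
        ∫⁻ ω in {ω | d ω = d₀}, ((f' ω * ENNReal.ofReal (1 - w ω d₀)) * 1 +
          (f' ω * ENNReal.ofReal (w ω d₀)) * ENNReal.ofReal (Real.exp (ζ d₀ (g ω)))) ∂P := by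
      refine setLIntegral_mono' (hd d₀) fun ω hω => ?_
      have hω' : d ω = d₀ := hω
      have e : f' ω = f ω * ENNReal.ofReal (Real.exp (-(c * L ω))) := rfl
      rw [hω', mul_one, mul_assoc (f' ω), ← mul_add, ← ENNReal.ofReal_mul (hw0 ω d₀),
        ← ENNReal.ofReal_add (sub_nonneg.2 (hw1 ω d₀))
          (mul_nonneg (hw0 ω d₀) (Real.exp_pos _).le), e, mul_assoc,
        ← ENNReal.ofReal_mul (Real.exp_pos _).le, sub_eq_neg_add, Real.exp_add]
      gcongr
      exact exp_mul_le_of_mem_Icc (hw0 ω d₀) (hw1 ω d₀)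
    refine h1.trans ?_
    have hlaw' := fun E hE F hF => hlaw E hE d₀ F hF
    rw [lintegral_add_left (((hA d₀).mono hm le_rfl).mul_const 1),
      setLIntegral_mul_of_law hm hg (hqm d₀) hlaw' (hA d₀)
        (k := fun _ => 1) measurable_const,
      setLIntegral_mul_of_law hm hg (hqm d₀) hlaw' (hB d₀) (hk d₀)]
    simp only [lintegral_const, measure_univ, mul_one, one_mul]
    refine (add_le_add_right (mul_le_mul_left (hexp d₀) _) _).trans (le_of_eq ?_)
    have hAq : Measurable fun ω => f' ω * ENNReal.ofReal (1 - w ω d₀) * ENNReal.ofReal (q ω d₀) :=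
      ((hA d₀).mul (hqm d₀)).mono hm le_rfl
    have hBq : Measurable fun ω => f' ω * ENNReal.ofReal (w ω d₀) * ENNReal.ofReal (q ω d₀) :=
      ((hB d₀).mul (hqm d₀)).mono hm le_rfl
    rw [← lintegral_const_mul _ hBq, ← lintegral_add_left hAq]
    refine lintegral_congr fun ω => ?_
    have e : q ω d₀ * (1 + c * (w ω d₀ * z d₀)) =
        (1 - w ω d₀) * q ω d₀ + (1 + c * z d₀) * (w ω d₀ * q ω d₀) := by ring
    rw [e, ENNReal.ofReal_add (mul_nonneg (sub_nonneg.2 (hw1 ω d₀)) (hq0 ω d₀))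
      (mul_nonneg (hc d₀) (mul_nonneg (hw0 ω d₀) (hq0 ω d₀))),
      ENNReal.ofReal_mul (sub_nonneg.2 (hw1 ω d₀)), ENNReal.ofReal_mul (hc d₀),
      ENNReal.ofReal_mul (hw0 ω d₀)]
    ring
  have hnn : ∀ ω d₀, 0 ≤ q ω d₀ * (1 + c * (w ω d₀ * z d₀)) := by
    intro ω d₀
    refine mul_nonneg (hq0 ω d₀) ?_
    have e : 1 + c * (w ω d₀ * z d₀) = (1 - w ω d₀) + w ω d₀ * (1 + c * z d₀) := by ring
    rw [e]
    exact add_nonneg (sub_nonneg.2 (hw1 ω d₀)) (mul_nonneg (hw0 ω d₀) (hc d₀))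
  have hU : ⋃ d₀, {ω | d ω = d₀} = Set.univ := by
    ext ω; simp
  calc _ = ∫⁻ ω in ⋃ d₀, {ω | d ω = d₀}, f ω * ENNReal.ofReal (Real.exp
        (w ω (d ω) * ζ (d ω) (g ω) - c * L ω)) ∂P := by rw [hU, setLIntegral_univ]
    _ = ∑ d₀, ∫⁻ ω in {ω | d ω = d₀}, f ω * ENNReal.ofReal (Real.exp
        (w ω (d ω) * ζ (d ω) (g ω) - c * L ω)) ∂P := by
        rw [lintegral_iUnion hd, tsum_fintype]
        intro i j hij
        exact Set.disjoint_left.2 fun ω h1 h2 => hij (h1.symm.trans h2)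
    _ ≤ ∑ d₀, ∫⁻ ω, f' ω * ENNReal.ofReal (q ω d₀ * (1 + c * (w ω d₀ * z d₀))) ∂P :=
        Finset.sum_le_sum fun d₀ _ => hpart d₀
    _ = ∫⁻ ω, f' ω * ENNReal.ofReal (1 + c * L ω) ∂P := by
        rw [← lintegral_finsetSum]
        · refine lintegral_congr fun ω => ?_
          rw [← Finset.mul_sum, ← ENNReal.ofReal_sum_of_nonneg fun d₀ _ => hnn ω d₀]
          congr 2
          simp only [hL, mul_add, mul_one, Finset.sum_add_distrib, hq1 ω, Finset.mul_sum]
          congr 1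
          exact Finset.sum_congr rfl fun d₀ _ => by ring
        · intro d₀ _
          refine Measurable.mono (hf'm.mul (ENNReal.measurable_ofReal.comp ?_)) hm le_rfl
          exact (hq d₀).mul ((measurable_const (a := (1 : ℝ))).add
            (((hw d₀).mul_const _).const_mul c))
    _ ≤ ∫⁻ ω, f' ω * ENNReal.ofReal (Real.exp (c * L ω)) ∂P := by
        refine lintegral_mono fun ω => ?_
        gcongr
        linarith [Real.add_one_le_exp (c * L ω)]
    _ = ∫⁻ ω, f ω ∂P := by
        refine lintegral_congr fun ω => ?_
        rw [hf', mul_assoc, ← ENNReal.ofReal_mul (Real.exp_pos _).le, ← Real.exp_add]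
        simp

end

/-! ### The algorithm's policies and the loss estimator. -/

namespace InfoTree

variable {X : ℕ → Type*} {A : Type*} (I : InfoTree X A) [Fintype A] {H : ℕ}

/-- The balanced policy of layer `l` is uniform at step `l` itself, so all actions at an infoset
share one learning rate, as Hedge requires. -/
lemma seqForm_balanced_self (l : ℕ) (x : X l) (a : A) :
    I.seqForm (I.balanced l) l x a = I.reach (I.balanced l) l x / Fintype.card A := by
  rw [seqForm, balanced, if_neg (lt_irrefl l), mul_one_div]

variable [Nonempty A]

lemma balancedCFR_pos (η : ℝ) (z : ℕ → Fin H → ∀ h : Fin H, X h × A × ℝ) :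
    ∀ t h (x : X h) a, 0 < I.balancedCFR η z t h x a
  | 0, h, x, a => by unfold balancedCFR; positivity
  | t + 1, h, x, a => by
      have ih := balancedCFR_pos η z t h x
      unfold balancedCFR
      split_ifs with hh
      · exact div_pos (mul_pos (ih a) (Real.exp_pos _))
          (Finset.sum_pos (fun b _ => mul_pos (ih b) (Real.exp_pos _)) Finset.univ_nonempty)
      · exact ih a

lemma sum_balancedCFR (η : ℝ) (z : ℕ → Fin H → ∀ h : Fin H, X h × A × ℝ) :
    ∀ t h (x : X h), ∑ a, I.balancedCFR η z t h x a = 1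
  | 0, h, x => by simp [balancedCFR]
  | t + 1, h, x => by
      unfold balancedCFR
      split_ifs with hh
      · dsimp only
        rw [← Finset.sum_div, div_self]
        exact (Finset.sum_pos (fun b _ => mul_pos (I.balancedCFR_pos η z t h x b)
          (Real.exp_pos _)) Finset.univ_nonempty).ne'
      · exact sum_balancedCFR η z t h x

lemma isPolicy_balancedCFR (η : ℝ) (z : ℕ → Fin H → ∀ h : Fin H, X h × A × ℝ) (t : ℕ) :
    IsPolicy H (I.balancedCFR η z t) := fun h _ x =>
  ⟨fun a => (I.balancedCFR_pos η z t h x a).le, I.sum_balancedCFR η z t h x⟩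

end InfoTree

namespace PlayerView

variable {H : ℕ} {X : ℕ → Type*} {A D : Type*} (V : PlayerView H X A D)

/-- The player's own trajectory in an episode with path `d` and gains `g`. -/
def trajectory (d : D) (g : Fin H → ℝ) : ∀ h : Fin H, X h × A × ℝ :=
  fun h => (V.info d h, V.act d h, g h)

lemma sum_one_sub_mem {H : ℕ} {g : Fin H → ℝ} (hg : ∀ h, g h ∈ Set.Icc (0 : ℝ) 1) (l : Fin H) :
    ∑ h ∈ Finset.Ici l, (1 - g h) ∈ Set.Icc (0 : ℝ) H := by
  constructor
  · exact Finset.sum_nonneg fun h _ => by linarith [(hg h).2]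
  · calc ∑ h ∈ Finset.Ici l, (1 - g h) ≤ ∑ h ∈ Finset.Ici l, (1 : ℝ) :=
          Finset.sum_le_sum fun h _ => by linarith [(hg h).1]
      _ ≤ ∑ h : Fin H, (1 : ℝ) :=
          Finset.sum_le_sum_of_subset_of_nonneg (Finset.subset_univ _) fun _ _ _ => zero_le_one
      _ = H := by simp

lemma measurable_cfLoss {Ω : Type*} [MeasurableSpace Ω] [Fintype D] {V : PlayerView H X A D}
    {κ : Ω → D → ℝ} {μ : Ω → Plan X A}
    (hκm : ∀ d₀, Measurable fun ω => κ ω d₀) (hμm : ∀ h x a, Measurable fun ω => μ ω h x a)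
    (l : Fin H) (x : X l) (a : A) : Measurable fun ω => V.cfLoss (κ ω) (μ ω) l x a := by
  classical
  refine Finset.measurable_fun_sum _ fun d _ => ?_
  split_ifs
  · exact ((hκm d).mul (Finset.measurable_fun_prod _ fun h _ => hμm _ _ _)).mul_const _
  · exact measurable_const

section

variable {Ω : Type*} {m : MeasurableSpace Ω} [mΩ : MeasurableSpace Ω] {P : Measure Ω}

/-- Given `m`, the path `d` and the gains `g` of an episode are distributed as if the player uses
the policy `π` and the environment the kernel `κ`. -/
def IsEpisode (P : Measure Ω) (m : MeasurableSpace Ω) (κ : Ω → D → ℝ) (π : Ω → Plan X A)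
    (d : Ω → D) (g : Ω → Fin H → ℝ) : Prop :=
  ∀ E, MeasurableSet[m] E → ∀ d₀, ∀ F, MeasurableSet F →
    P (E ∩ {ω | d ω = d₀} ∩ {ω | g ω ∈ F}) =
      V.gains d₀ F * ∫⁻ ω in E, ENNReal.ofReal (κ ω d₀ * V.weight (π ω) d₀) ∂P

variable {V} in
lemma IsEpisode.ae_gain_mem [Fintype D] {κ : Ω → D → ℝ} {π : Ω → Plan X A} {d : Ω → D}
    {g : Ω → Fin H → ℝ} (h : V.IsEpisode P m κ π d g) :
    ∀ᵐ ω ∂P, ∀ h, g ω h ∈ Set.Icc (0 : ℝ) 1 := by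
  set F : Set (Fin H → ℝ) := {r | ∀ h, r h ∈ Set.Icc (0 : ℝ) 1} with hF
  have hFm : MeasurableSet F := by
    rw [hF, Set.ofPred_forall]
    exact MeasurableSet.iInter fun h => measurable_pi_apply h measurableSet_Icc
  rw [ae_iff]
  refine measure_mono_null (t := ⋃ d₀, Set.univ ∩ {ω | d ω = d₀} ∩ {ω | g ω ∈ Fᶜ}) ?_ ?_
  · intro ω hω
    simp only [Set.mem_iUnion]
    exact ⟨d ω, ⟨trivial, rfl⟩, hω⟩
  · refine measure_iUnion_null fun d₀ => ?_
    rw [h Set.univ (@MeasurableSet.univ _ m) d₀ Fᶜ hFm.compl]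
    have h0 : V.gains d₀ Fᶜ = 0 := V.gains_supp d₀
    rw [h0, zero_mul]

end

variable [Fintype A]

/-- The sequence-form weight of the exploration policy of layer `l` at `x`. -/
def base (l : Fin H) (x : X l) : ℝ :=
  V.tree.reach (V.tree.balanced l) l x / Fintype.card A

/-- The estimated loss of `(x, a)` in an episode with path `d` and gains `g`. -/
def estimator (l : Fin H) (x : X l) (d : D) (g : Fin H → ℝ) (a : A) : ℝ :=
  V.tree.lossEstimator l (V.trajectory d g) x a

open Classical in
lemma estimator_eq (l : Fin H) (x : X l) (d : D) (g : Fin H → ℝ) (a : A) :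
    V.estimator l x d g a = if (V.info d l, V.act d l) = (x, a) then
      (∑ h ∈ Finset.Ici l, (1 - g h)) / V.base l x else 0 := by
  have e : (H : ℝ) - ((l : ℕ) : ℝ) - ∑ h ∈ Finset.Ici l, g h = ∑ h ∈ Finset.Ici l, (1 - g h) := by
    rw [Finset.sum_sub_distrib, Finset.sum_const, Fin.card_Ici, nsmul_eq_mul, mul_one,
      Nat.cast_sub l.2.le]
  unfold estimator InfoTree.lossEstimator
  rw [InfoTree.seqForm_balanced_self, ← base]
  by_cases hp : (V.info d l, V.act d l) = (x, a)
  · have hp' : ((V.trajectory d g l).1, (V.trajectory d g l).2.1) = (x, a) := hp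
    rw [if_pos hp, if_pos hp', ← e, div_mul_eq_mul_div, one_mul]
    rfl
  · have hp' : ¬ ((V.trajectory d g l).1, (V.trajectory d g l).2.1) = (x, a) := hp
    rw [if_neg hp, if_neg hp', zero_div, zero_mul]

lemma measurable_estimator (l : Fin H) (x : X l) (d : D) (a : A) :
    Measurable fun g => V.estimator l x d g a := by
  classical
  simp_rw [V.estimator_eq]
  split_ifs
  · exact (Finset.measurable_fun_sum _ fun h _ =>
      measurable_const.sub (measurable_pi_apply h)).div_const _
  · exact measurable_const

/-- `D` carries no σ-algebra, so measurability comes from a finite decomposition over the events `{d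
= d₀}`. -/
lemma measurable_estimator_comp {Ω : Type*} [MeasurableSpace Ω] [Fintype D] {d : Ω → D} (hd : ∀ d₀, MeasurableSet {ω | d ω = d₀})
    {g : Ω → Fin H → ℝ} (hg : Measurable g) (l : Fin H) (x : X l) (a : A) :
    Measurable fun ω => V.estimator l x (d ω) (g ω) a := by
  classical
  have e : (fun ω => V.estimator l x (d ω) (g ω) a) = fun ω => ∑ d₀,
      Set.indicator {ω | d ω = d₀} (fun ω => V.estimator l x d₀ (g ω) a) ω := by
    funext ω
    rw [Finset.sum_eq_single (d ω)]
    · simp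
    · intro d₀ _ hne
      exact Set.indicator_of_notMem (fun h => hne h.symm) _
    · intro h
      exact absurd (Finset.mem_univ _) h
  rw [e]
  exact Finset.measurable_fun_sum _ fun d₀ _ =>
    ((V.measurable_estimator l x d₀ a).comp hg).indicator (hd d₀)

variable [∀ h, Fintype (X h)] [Nonempty A]

lemma base_pos (l : Fin H) (x : X l) : 0 < V.base l x := by
  have := V.tree.reach_pos (H := H) (fun h _ => V.children.balanced_pos l.2 h) l.2.le x
  unfold base
  positivity

/-- The factor `base` cancels the importance weight. The range is thus independent of how rarely `x`
is explored, and the Hedge exponents are at most ηH. -/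
lemma estimator_mem {g : Fin H → ℝ} (hg : ∀ h, g h ∈ Set.Icc (0 : ℝ) 1) (l : Fin H) (x : X l)
    (d : D) (a : A) : V.base l x * V.estimator l x d g a ∈ Set.Icc (0 : ℝ) H := by
  classical
  rw [estimator_eq]
  split_ifs
  · rw [mul_div_cancel₀ _ (V.base_pos l x).ne']
    exact sum_one_sub_mem hg l
  · simp

open Classical in
lemma integral_estimator (l : Fin H) (x : X l) (d : D) (a : A) :
    V.base l x * ∫ g, V.estimator l x d g a ∂(V.gains d) =
      if (V.info d l, V.act d l) = (x, a) then V.loss l d else 0 := by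
  have := V.gains_prob d
  have hint : ∀ h, Integrable (fun g : Fin H → ℝ => 1 - g h) (V.gains d) := fun h =>
    (integrable_const _).sub (V.integrable_gain d h)
  simp_rw [V.estimator_eq]
  split_ifs
  · rw [integral_div, integral_finsetSum _ fun h _ => hint h, mul_div_cancel₀ _ (V.base_pos l x).ne', loss]
    refine Finset.sum_congr rfl fun h _ => ?_
    rw [integral_sub (integrable_const _) (V.integrable_gain d h)]
    simp [meanGain]
  · simp

/-- The estimator scaled by `base / H` lies in [0, 1], where the exponential is below its chord.
This bounds the exponential moment by the mean alone, for `θ` of either sign, and makes the later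
deviation bounds multiplicative. -/
lemma lintegral_exp_estimator_le (hH : 0 < H) (θ : ℝ) (l : Fin H) (x : X l) (d : D) (a : A) :
    ∫⁻ g, ENNReal.ofReal (Real.exp (V.base l x / H * θ * V.estimator l x d g a)) ∂(V.gains d) ≤
      ENNReal.ofReal (1 + V.base l x / H * (Real.exp θ - 1) *
        ∫ g, V.estimator l x d g a ∂(V.gains d)) := by
  have := V.gains_prob d
  have hH' : (0 : ℝ) < H := by exact_mod_cast hH
  have hb := V.base_pos l x
  have hmem : ∀ᵐ g ∂(V.gains d), V.base l x / H * V.estimator l x d g a ∈ Set.Icc (0 : ℝ) 1 := by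
    filter_upwards [V.gains_supp d] with g hg
    have h1 := V.estimator_mem hg l x d a
    rw [div_mul_eq_mul_div]
    exact ⟨div_nonneg h1.1 hH'.le, (div_le_one hH').2 h1.2⟩
  have hint : Integrable (fun g => V.base l x / H * V.estimator l x d g a) (V.gains d) := by
    refine Integrable.of_bound (C := 1)
      ((V.measurable_estimator l x d a).const_mul _).aestronglyMeasurable ?_
    filter_upwards [hmem] with g hg
    rw [Real.norm_eq_abs, abs_le]
    constructor <;> linarith [hg.1, hg.2]
  have hint2 : Integrable (fun g => 1 + V.base l x / H * V.estimator l x d g a *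
      (Real.exp θ - 1)) (V.gains d) := (integrable_const _).add (hint.mul_const _)
  have hle : ∀ᵐ g ∂(V.gains d), Real.exp (V.base l x / H * θ * V.estimator l x d g a) ≤
      1 + V.base l x / H * V.estimator l x d g a * (Real.exp θ - 1) := by
    filter_upwards [hmem] with g hg
    have h1 := exp_mul_le_of_mem_Icc (u := θ) hg.1 hg.2
    have e : V.base l x / H * θ * V.estimator l x d g a =
      V.base l x / H * V.estimator l x d g a * θ := by ring
    rw [e]
    linarith
  calc _ ≤ ∫⁻ g, ENNReal.ofReal (1 + V.base l x / H * V.estimator l x d g a *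
        (Real.exp θ - 1)) ∂(V.gains d) := by
        refine lintegral_mono_ae ?_
        filter_upwards [hle] with g hg using ENNReal.ofReal_le_ofReal hg
    _ = ENNReal.ofReal (∫ g, 1 + V.base l x / H * V.estimator l x d g a *
        (Real.exp θ - 1) ∂(V.gains d)) := by
        rw [ofReal_integral_eq_lintegral_ofReal hint2]
        filter_upwards [hle] with g hg using (Real.exp_pos _).le.trans hg
    _ = _ := by
        rw [integral_add (integrable_const _) (hint.mul_const _), integral_mul_const,
          integral_const_mul]
        simp only [integral_const, probReal_univ, smul_eq_mul, mul_one]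
        congr 1
        ring

variable [Fintype D] {V}

/-- Unbiasedness: under the sampling policy the player's own weight up to `(x, a)` is `base`,
exactly the denominator of the estimator, and from step `l + 1` on she follows `μ`, as in `cfLoss`.
-/
lemma IsKernel.sum_mul_estimator {κ : D → ℝ} (hκ : V.IsKernel κ) (μ : Plan X A) (l : Fin H)
    (x : X l) (u : A → ℝ) :
    ∑ d, κ d * V.weight (V.tree.explore l μ) d *
        (u (V.act d l) * ∫ g, V.estimator l x d g (V.act d l) ∂(V.gains d)) =
      ∑ a, u a * V.cfLoss κ μ l x a := by
  classical
  have hb := (V.base_pos l x).ne'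
  have h1 : ∀ a, V.cfLoss κ μ l x a = (V.base l x)⁻¹ * ∑ d,
      if (V.info d l, V.act d l) = (x, a) then
        κ d * V.weight (V.tree.explore l μ) d * V.loss l d else 0 := by
    intro a
    have h2 := hκ.seqForm_mul_cfLoss (V.tree.balanced l) μ l x a
    rw [InfoTree.seqForm_balanced_self, ← base] at h2
    change _ = (V.base l x)⁻¹ * ∑ d, if (V.info d l, V.act d l) = (x, a) then
        κ d * V.weight (Plan.splice l (V.tree.balanced l) μ) d * V.loss l d else 0
    rw [← h2]
    field_simp
  simp_rw [h1, Finset.mul_sum]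
  rw [Finset.sum_comm]
  refine Finset.sum_congr rfl fun d _ => ?_
  rw [Finset.sum_eq_single (V.act d l)]
  · have h3 := V.integral_estimator l x d (V.act d l)
    have h4 : ∫ g, V.estimator l x d g (V.act d l) ∂(V.gains d) = (V.base l x)⁻¹ *
      if (V.info d l, V.act d l) = (x, V.act d l) then V.loss l d else 0 := by
      rw [← h3]
      field_simp
    rw [h4]
    split_ifs <;> ring
  · intro a _ ha
    rw [if_neg fun e => ha (Prod.mk.inj e).2.symm]
    ring
  · intro h
    exact absurd (Finset.mem_univ _) h

section

variable {Ω : Type*} {m : MeasurableSpace Ω} [mΩ : MeasurableSpace Ω] {P : Measure Ω}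

lemma lintegral_mul_exp_estimator_le (hH : 0 < H) (hm : m ≤ mΩ) {κ : Ω → D → ℝ}
    {μ : Ω → Plan X A} {d : Ω → D} {g : Ω → Fin H → ℝ} {l : Fin H}
    (hlaw : V.IsEpisode P m κ (fun ω => V.tree.explore l (μ ω)) d g)
    (hd : ∀ d₀, MeasurableSet {ω | d ω = d₀}) (hg : Measurable g)
    (hκ : ∀ ω, V.IsKernel (κ ω)) (hκm : ∀ d₀, Measurable[m] fun ω => κ ω d₀)
    (hμ : ∀ ω, IsPolicy H (μ ω)) (hμm : ∀ h x a, Measurable[m] fun ω => μ ω h x a)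
    (x : X l) {u : Ω → A → ℝ} (hum : ∀ a, Measurable[m] fun ω => u ω a)
    (hu0 : ∀ ω a, 0 ≤ u ω a) (hu1 : ∀ ω a, u ω a ≤ 1) (θ : ℝ)
    {f : Ω → ENNReal} (hf : Measurable[m] f) :
    ∫⁻ ω, f ω * ENNReal.ofReal (Real.exp (V.base l x / H *
      (θ * ∑ a, u ω a * V.estimator l x (d ω) (g ω) a -
        (Real.exp θ - 1) * ∑ a, u ω a * V.cfLoss (κ ω) (μ ω) l x a))) ∂P ≤ ∫⁻ ω, f ω ∂P := by
  have hH' : (0 : ℝ) < H := by exact_mod_cast hH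
  have hb := V.base_pos l x
  have := V.gains_prob
  have hpol := fun ω => V.children.isPolicy_explore l.2 (hμ ω)
  have key := lintegral_mul_exp_le hm hd hg (ρ := V.gains)
    (q := fun ω d₀ => κ ω d₀ * V.weight (V.tree.explore l (μ ω)) d₀)
    (w := fun ω d₀ => u ω (V.act d₀ l))
    (ζ := fun d₀ r => V.base l x / H * θ * V.estimator l x d₀ r (V.act d₀ l))
    (z := fun d₀ => ∫ r, V.estimator l x d₀ r (V.act d₀ l) ∂(V.gains d₀))
    (c := V.base l x / H * (Real.exp θ - 1)) (P := P)
    (fun d₀ => (hκm d₀).mul (Finset.measurable_fun_prod _ fun h _ => by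
      unfold InfoTree.explore
      split_ifs
      · exact measurable_const
      · exact hμm _ _ _))
    (fun ω d₀ => mul_nonneg ((hκ ω).nonneg d₀) (V.weight_nonneg (hpol ω) d₀))
    (fun ω => (hκ ω).sum_eq_one _ (hpol ω)) hlaw (fun d₀ => hum _) (fun ω d₀ => hu0 _ _)
    (fun ω d₀ => hu1 _ _) (fun d₀ => (V.measurable_estimator l x d₀ _).const_mul _)
    (fun d₀ => ?_) (fun d₀ => V.lintegral_exp_estimator_le hH θ l x d₀ _) hf
  · refine le_trans (le_of_eq (lintegral_congr fun ω => ?_)) key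
    congr 3
    have e1 : ∑ a, u ω a * V.estimator l x (d ω) (g ω) a =
        u ω (V.act (d ω) l) * V.estimator l x (d ω) (g ω) (V.act (d ω) l) := by
      classical
      refine Finset.sum_eq_single _ (fun a _ ha => ?_) fun h => absurd (Finset.mem_univ _) h
      rw [estimator_eq, if_neg fun e => ha (Prod.mk.inj e).2.symm, mul_zero]
    have e2 := (hκ ω).sum_mul_estimator (μ ω) l x (u ω)
    rw [e2, e1]
    ring
  -- The side condition that 1 + cz is nonnegative holds because it is a chord value lying above a
  -- positive exponential.
  · classical
    have h1 : V.base l x / H * ∫ r, V.estimator l x d₀ r (V.act d₀ l) ∂(V.gains d₀) ∈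
        Set.Icc (0 : ℝ) 1 := by
      rw [div_mul_eq_mul_div, V.integral_estimator]
      split_ifs
      · exact ⟨div_nonneg (V.loss_nonneg l d₀) hH'.le, (div_le_one hH').2 (V.loss_le l d₀)⟩
      · simp
    have h2 := exp_mul_le_of_mem_Icc (u := θ) h1.1 h1.2
    nlinarith [Real.exp_pos (V.base l x / H *
      (∫ r, V.estimator l x d₀ r (V.act d₀ l) ∂(V.gains d₀)) * θ)]

end

end PlayerView

/-! ### High-probability regret of one player. -/

namespace PlayerView

open Classical in
/-- The weights whose deviations have to be controlled: the current policy, and each single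
action. -/
def testWeight {A : Type*} (w : A → ℝ) : Option A → A → ℝ
  | none => w
  | some a => fun b => if b = a then 1 else 0

lemma testWeight_mem {A : Type*} {w : A → ℝ} (hw : ∀ a, w a ∈ Set.Icc (0 : ℝ) 1) (o : Option A)
    (a : A) : testWeight w o a ∈ Set.Icc (0 : ℝ) 1 := by
  cases o with
  | none => exact hw a
  | some b =>
    simp only [testWeight]
    split_ifs <;> norm_num

lemma measurable_testWeight {A Ω : Type*} [MeasurableSpace Ω] {w : Ω → A → ℝ}
    (hw : ∀ a, Measurable fun ω => w ω a) (o : Option A) (a : A) :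
    Measurable fun ω => testWeight (w ω) o a := by
  cases o with
  | none => exact hw a
  | some b => exact measurable_const

variable {H : ℕ} {X : ℕ → Type*} {A D : Type*} (V : PlayerView H X A D) [Fintype A]
  {Ω : Type*}

/-- The policies of Balanced CFR with Hedge, if `(d t l, g t l)` is the episode of round `t` in
which the player explores for layer `l`. -/
def cfrPolicy (η : ℝ) (d : ℕ → Fin H → Ω → D) (g : ℕ → Fin H → Ω → Fin H → ℝ) (t : ℕ) (ω : Ω) :
    Plan X A :=
  V.tree.balancedCFR η (fun t l => V.trajectory (d t l ω) (g t l ω)) t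

lemma isPolicy_cfrPolicy [Nonempty A] (η : ℝ) (d : ℕ → Fin H → Ω → D)
    (g : ℕ → Fin H → Ω → Fin H → ℝ) (t : ℕ) (ω : Ω) : IsPolicy H (V.cfrPolicy η d g t ω) :=
  V.tree.isPolicy_balancedCFR _ _ _

variable {V} in
/-- The regret of Hedge at one infoset. -/
lemma cfrPolicy_regret [∀ h, Fintype (X h)] [Nonempty A] {η : ℝ} (hη : 0 ≤ η) {d : ℕ → Fin H → Ω → D}
    {g : ℕ → Fin H → Ω → Fin H → ℝ} {T : ℕ} {ω : Ω}
    (hg : ∀ t < T, ∀ l h, g t l ω h ∈ Set.Icc (0 : ℝ) 1) (l : Fin H) (x : X l) (a : A) :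
    (1 - η * H / 2) * (η * V.base l x * ∑ t ∈ Finset.range T,
        ∑ b, V.cfrPolicy η d g t ω l x b * V.estimator l x (d t l ω) (g t l ω) b) ≤
      η * V.base l x * ∑ t ∈ Finset.range T, V.estimator l x (d t l ω) (g t l ω) a +
        Real.log (Fintype.card A) := by
  refine hedge_regret (w := fun t => V.cfrPolicy η d g t ω l x)
    (Z := fun t => V.estimator l x (d t l ω) (g t l ω)) (fun _ => rfl)
    (fun t b => V.tree.balancedCFR_pos _ _ _ _ _ _)
    (fun t => V.tree.sum_balancedCFR _ _ _ _ _) (fun t b => ?_) (fun t ht b => ?_)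
    (fun t ht b => ?_) a
  · simp only [cfrPolicy, InfoTree.balancedCFR, dif_pos l.2, InfoTree.seqForm_balanced_self]
    rfl
  · rw [mul_assoc]
    exact mul_nonneg hη (V.estimator_mem (hg t ht l) l x _ b).1
  · rw [mul_assoc]
    exact mul_le_mul_of_nonneg_left (V.estimator_mem (hg t ht l) l x _ b).2 hη

variable [Fintype D]

/-- `T` rounds of Balanced CFR with Hedge. In round `t`, the environment and the opponent
contribute the kernel `κ t`. The information available before the episode in which
the player explores for layer `l` is `m t l`. -/
structure IsRun [mΩ : MeasurableSpace Ω] (P : Measure Ω) (m : ℕ → Fin H → MeasurableSpace Ω)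
    (η : ℝ) (T : ℕ) (κ : ℕ → Ω → D → ℝ) (d : ℕ → Fin H → Ω → D)
    (g : ℕ → Fin H → Ω → Fin H → ℝ) : Prop where
  le : ∀ t < T, ∀ l, m t l ≤ mΩ
  -- Concentration is applied along `t` for one layer at a time, so information has to grow only at
  -- fixed `l`.
  mono : ∀ t < T, ∀ s < t, ∀ l, m s l ≤ m t l
  path_past : ∀ t < T, ∀ s < t, ∀ l l' d₀, MeasurableSet[m t l] {ω | d s l' ω = d₀}
  gain_past : ∀ t < T, ∀ s < t, ∀ l l', Measurable[m t l] (g s l')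
  path_measurable : ∀ t < T, ∀ l d₀, MeasurableSet {ω | d t l ω = d₀}
  gain_measurable : ∀ t < T, ∀ l, Measurable (g t l)
  kernel : ∀ t < T, ∀ ω, V.IsKernel (κ t ω)
  kernel_measurable : ∀ t < T, ∀ l d₀, Measurable[m t l] fun ω => κ t ω d₀
  episode : ∀ t < T, ∀ l, V.IsEpisode P (m t l) (κ t)
    (fun ω => V.tree.explore l (V.cfrPolicy η d g t ω)) (d t l) (g t l)

lemma measurable_cfrPolicy [MeasurableSpace Ω] (η : ℝ) {d : ℕ → Fin H → Ω → D}
    {g : ℕ → Fin H → Ω → Fin H → ℝ} : ∀ {t : ℕ},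
    (∀ s < t, ∀ l d₀, MeasurableSet {ω | d s l ω = d₀}) → (∀ s < t, ∀ l, Measurable (g s l)) →
    ∀ h x a, Measurable fun ω => V.cfrPolicy η d g t ω h x a
  | 0, _, _, h, x, a => measurable_const
  | t + 1, hd, hg, h, x, a => by
      have ih := measurable_cfrPolicy η (d := d) (g := g) (t := t)
        (fun s hs => hd s (by omega)) (fun s hs => hg s (by omega)) h x
      unfold cfrPolicy InfoTree.balancedCFR
      by_cases hh : h < H
      · simp only [dif_pos hh]
        have h1 : ∀ a, Measurable fun ω => V.cfrPolicy η d g t ω h x a *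
            Real.exp (-(η * V.tree.seqForm (V.tree.balanced h) h x a *
              V.estimator ⟨h, hh⟩ x (d t ⟨h, hh⟩ ω) (g t ⟨h, hh⟩ ω) a)) := fun a =>
          (ih a).mul (Real.measurable_exp.comp ((V.measurable_estimator_comp
            (hd t (by omega) _) (hg t (by omega) _) ⟨h, hh⟩ x a).const_mul _).neg)
        exact (h1 a).div (Finset.measurable_fun_sum _ fun b _ => h1 b)
      · simp only [dif_neg hh]
        exact ih a

variable {V} in
lemma IsRun.measurable_policy [MeasurableSpace Ω] {P : Measure Ω}
    {m : ℕ → Fin H → MeasurableSpace Ω} {η : ℝ} {T : ℕ} {κ : ℕ → Ω → D → ℝ} {d : ℕ → Fin H → Ω → D}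
    {g : ℕ → Fin H → Ω → Fin H → ℝ} (h : V.IsRun P m η T κ d g) (t : ℕ) (ht : t < T) (l : Fin H) (k : ℕ)
    (x : X k) (a : A) : Measurable[m t l] fun ω => V.cfrPolicy η d g t ω k x a :=
  @measurable_cfrPolicy H X A D V _ Ω _ (m t l) η d g t
    (fun s hs l' d₀ => h.path_past t ht s hs l l' d₀)
    (fun s hs l' => h.gain_past t ht s hs l l') k x a

variable {V} in
lemma measurable_deviation [MeasurableSpace Ω] {κ : Ω → D → ℝ} {d : Ω → D}
    (hd : ∀ d₀, MeasurableSet {ω | d ω = d₀}) {g : Ω → Fin H → ℝ} (hg : Measurable g)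
    (hκm : ∀ d₀, Measurable fun ω => κ ω d₀)
    {μ : Ω → Plan X A} (hμm : ∀ h x a, Measurable fun ω => μ ω h x a) (l : Fin H) (x : X l)
    {u : Ω → A → ℝ} (hu : ∀ a, Measurable fun ω => u ω a) (θ : ℝ) :
    Measurable fun ω => V.base l x / H *
      (θ * ∑ a, u ω a * V.estimator l x (d ω) (g ω) a -
        (Real.exp θ - 1) * ∑ a, u ω a * V.cfLoss (κ ω) (μ ω) l x a) := by
  refine Measurable.const_mul (Measurable.sub (Measurable.const_mul ?_ _)
    (Measurable.const_mul ?_ _)) _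
  · exact Finset.measurable_fun_sum _ fun a _ =>
      (hu a).mul (V.measurable_estimator_comp hd hg l x a)
  · exact Finset.measurable_fun_sum _ fun a _ => (hu a).mul (measurable_cfLoss hκm hμm l x a)

variable [∀ h, Fintype (X h)] [Nonempty A] {V}

variable [mΩ : MeasurableSpace Ω] {P : Measure Ω} {m : ℕ → Fin H → MeasurableSpace Ω}
    {η : ℝ} {T : ℕ} {κ : ℕ → Ω → D → ℝ} {d : ℕ → Fin H → Ω → D} {g : ℕ → Fin H → Ω → Fin H → ℝ}

/-- Concentration of the sums of weighted loss estimates at one infoset. -/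
lemma IsRun.measure_deviation_le [IsProbabilityMeasure P] (hH : 0 < H)
    (h : V.IsRun P m η T κ d g) {l : Fin H} (x : X l) {u : ℕ → Ω → A → ℝ}
    (hum : ∀ t < T, ∀ a, Measurable[m t l] fun ω => u t ω a)
    (hu0 : ∀ t ω a, 0 ≤ u t ω a) (hu1 : ∀ t ω a, u t ω a ≤ 1) (θ ι : ℝ) :
    P {ω | ι ≤ ∑ t ∈ Finset.range T, V.base l x / H *
      (θ * ∑ a, u t ω a * V.estimator l x (d t l ω) (g t l ω) a -
        (Real.exp θ - 1) * ∑ a, u t ω a *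
          V.cfLoss (κ t ω) (V.cfrPolicy η d g t ω) l x a)} ≤
      ENNReal.ofReal (Real.exp (-ι)) := by
  have hκm := h.kernel_measurable
  have hpm := h.measurable_policy
  -- The σ-algebra is left free because it is needed twice: for the information of a later round,
  -- and for the ambient one.
  have hU : ∀ t < T, ∀ m' : MeasurableSpace Ω, m t l ≤ m' →
      (∀ d₀, MeasurableSet[m'] {ω | d t l ω = d₀}) → Measurable[m'] (g t l) →
      Measurable[m'] fun ω => V.base l x / H *
      (θ * ∑ a, u t ω a * V.estimator l x (d t l ω) (g t l ω) a -
        (Real.exp θ - 1) * ∑ a, u t ω a *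
          V.cfLoss (κ t ω) (V.cfrPolicy η d g t ω) l x a) := fun t ht m' hm' hd' hg' =>
    @measurable_deviation H X A D V _ Ω _ m' _ _ hd' _ hg'
      (fun d₀ => (hκm t ht l d₀).mono hm' le_rfl) _
      (fun k x a => (hpm t ht l k x a).mono hm' le_rfl) l x _
      (fun a => (hum t ht a).mono hm' le_rfl) θ
  refine measure_sum_ge_le (m := fun t => m t l) (fun t ht s hs => ?_) (fun t ht => ?_)
    (fun t ht f hf => ?_) ι
  · exact hU s (hs.trans ht) _ (h.mono t ht s hs l) (fun d₀ => h.path_past t ht s hs l l d₀)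
      (h.gain_past t ht s hs l l)
  · exact hU t ht _ (h.le t ht l) (h.path_measurable t ht l) (h.gain_measurable t ht l)
  · exact lintegral_mul_exp_estimator_le hH (h.le t ht l) (h.episode t ht l)
      (h.path_measurable t ht l) (h.gain_measurable t ht l) (h.kernel t ht)
      (h.kernel_measurable t ht l) (fun ω => V.isPolicy_cfrPolicy η d g t ω) (h.measurable_policy t ht l) x
      (hum t ht) (hu0 t) (hu1 t) θ hf

/-- With high probability, the regret of Balanced CFR with Hedge is small. -/
theorem IsRun.measure_regret_le [IsProbabilityMeasure P] (hH : 0 < H)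
    (h : V.IsRun P m η T κ d g) (hη : 0 < η) (hηH : η * H ≤ 1) {ι : ℝ}
    (hι : Real.log (Fintype.card A) ≤ ι) :
    P {ω | ¬ ∀ μ', IsPolicy H μ' → ∑ t ∈ Finset.range T,
        (V.value (κ t ω) μ' - V.value (κ t ω) (V.cfrPolicy η d g t ω)) ≤
      2 * (η * H) * (T * (H : ℝ) ^ 2) + 3 * ι / η * numPairs H X A} ≤
      ENNReal.ofReal (2 * numPairs H X A * Real.exp (-ι)) := by
  classical
  have hH' : (0 : ℝ) < H := by exact_mod_cast hH
  set θ := η * H with hθ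
  have hθ0 : 0 < θ := mul_pos hη hH'
  -- Two opposite tails are needed: the estimated loss of the played policies must not be far below
  -- the true one, that of a fixed action not far above.
  set sgn : Option A → ℝ := fun o => o.elim (-θ) (fun _ => θ) with hsgn
  set bad : (Σ l : Fin H, X l × Option A) → Set Ω := fun p =>
    {ω | ι ≤ ∑ t ∈ Finset.range T, V.base p.1 p.2.1 / H *
      (sgn p.2.2 * ∑ a, testWeight (V.cfrPolicy η d g t ω p.1 p.2.1) p.2.2 a *
          V.estimator p.1 p.2.1 (d t p.1 ω) (g t p.1 ω) a -
        (Real.exp (sgn p.2.2) - 1) * ∑ a,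
          testWeight (V.cfrPolicy η d g t ω p.1 p.2.1) p.2.2 a *
          V.cfLoss (κ t ω) (V.cfrPolicy η d g t ω) p.1 p.2.1 a)} with hbad
  have hbadP : ∀ p, P (bad p) ≤ ENNReal.ofReal (Real.exp (-ι)) := by
    rintro ⟨l, x, o⟩
    have hpol : ∀ t ω b, V.cfrPolicy η d g t ω l x b ∈ Set.Icc (0 : ℝ) 1 := by
      intro t ω b
      have h1 := V.isPolicy_cfrPolicy η d g t ω l l.2 x
      refine ⟨h1.1 b, ?_⟩
      rw [← h1.2]
      exact Finset.single_le_sum (fun b _ => h1.1 b) (Finset.mem_univ b)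
    exact h.measure_deviation_le hH x
      (fun t ht => @measurable_testWeight A Ω (m t l) _ (h.measurable_policy t ht l l x) o)
      (fun t ω a => (testWeight_mem (hpol t ω) o a).1)
      (fun t ω a => (testWeight_mem (hpol t ω) o a).2) _ _
  have hgain : ∀ᵐ ω ∂P, ∀ t < T, ∀ l h, g t l ω h ∈ Set.Icc (0 : ℝ) 1 := by
    rw [ae_all_iff]
    intro t
    by_cases ht : t < T
    · have := ae_all_iff.2 fun l => (h.episode t ht l).ae_gain_mem
      filter_upwards [this] with ω hω _ using hω
    · exact Filter.Eventually.of_forall fun ω h => absurd h ht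
  -- This part is deterministic: the bad events do not mention the comparator `μ'`, which may
  -- therefore depend on `ω`.
  have hgood : ∀ ω, (∀ t < T, ∀ l h, g t l ω h ∈ Set.Icc (0 : ℝ) 1) → (∀ p, ω ∉ bad p) →
      ∀ μ', IsPolicy H μ' → ∑ t ∈ Finset.range T,
        (V.value (κ t ω) μ' - V.value (κ t ω) (V.cfrPolicy η d g t ω)) ≤
      2 * (η * H) * (T * (H : ℝ) ^ 2) + 3 * ι / η * numPairs H X A := by
    intro ω hω hnb μ' hμ'
    refine regret_le (V := V) (fun t ht => h.kernel t ht ω)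
      (fun t _ => V.isPolicy_cfrPolicy η d g t ω) hθ0.le (fun l x a => ?_) hμ'
    have hb := V.base_pos l x
    set SL := ∑ t ∈ Finset.range T, ∑ b, V.cfrPolicy η d g t ω l x b *
      V.cfLoss (κ t ω) (V.cfrPolicy η d g t ω) l x b with hSL
    set LA := ∑ t ∈ Finset.range T, V.cfLoss (κ t ω) (V.cfrPolicy η d g t ω) l x a with hLA
    set SZ := ∑ t ∈ Finset.range T, ∑ b, V.cfrPolicy η d g t ω l x b *
      V.estimator l x (d t l ω) (g t l ω) b with hSZ
    set ZA := ∑ t ∈ Finset.range T, V.estimator l x (d t l ω) (g t l ω) a with hZA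
    have hSL0 : 0 ≤ SL := Finset.sum_nonneg fun t ht => Finset.sum_nonneg fun b _ =>
      mul_nonneg ((V.isPolicy_cfrPolicy η d g t ω l l.2 x).1 b)
        ((h.kernel t (Finset.mem_range.1 ht) ω).cfLoss_nonneg
          (V.isPolicy_cfrPolicy η d g t ω) l x b)
    have hLA0 : 0 ≤ LA := Finset.sum_nonneg fun t ht =>
      (h.kernel t (Finset.mem_range.1 ht) ω).cfLoss_nonneg
          (V.isPolicy_cfrPolicy η d g t ω) l x a
    have h1 := cfrPolicy_regret (V := V) hη.le (d := d) (g := g) (T := T) (ω := ω) hω l x a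
    have h2 := hnb ⟨l, x, none⟩
    have h3 := hnb ⟨l, x, some a⟩
    simp only [hbad, Set.mem_ofPred_eq, not_le, testWeight, hsgn, Option.elim, ← Finset.mul_sum,
      Finset.sum_sub_distrib, ite_mul, one_mul, zero_mul, Finset.sum_ite_eq', Finset.mem_univ,
      if_true] at h2 h3
    change V.base l x / H * (-θ * SZ - (Real.exp (-θ) - 1) * SL) < ι at h2
    change V.base l x / H * (θ * ZA - (Real.exp θ - 1) * LA) < ι at h3
    change (1 - θ / 2) * (η * V.base l x * SZ) ≤ η * V.base l x * ZA + _ at h1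
    set β := η * V.base l x with hβ
    have hβ0 : 0 < β := mul_pos hη hb
    have eβ : β = V.base l x / H * θ := by rw [hβ, hθ]; field_simp
    have hbH : 0 ≤ V.base l x / H := (div_pos hb hH').le
    have h2' : β * ((1 - θ / 2) * SL - SZ) ≤ ι := by
      refine le_trans ?_ h2.le
      rw [eβ, mul_assoc]
      refine mul_le_mul_of_nonneg_left ?_ hbH
      nlinarith [mul_le_mul_of_nonneg_right (one_sub_exp_neg_ge hθ0.le) hSL0]
    have h3' : β * (ZA - (1 + θ) * LA) ≤ ι := by
      refine le_trans ?_ h3.le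
      rw [eβ, mul_assoc]
      refine mul_le_mul_of_nonneg_left ?_ hbH
      nlinarith [mul_le_mul_of_nonneg_right (exp_sub_one_le hθ0.le hηH) hLA0]
    have hι0 : 0 ≤ ι := by
      refine le_trans (Real.log_nonneg ?_) hι
      exact_mod_cast Fintype.card_pos
    -- One `ι` comes from each deviation bound and one from log A in the Hedge bound. The two
    -- factors 1 − θ/2 combine through (1 − θ/2)² ≥ 1 − θ.
    have h4 : β * (SL - LA - θ * (SL + LA)) ≤ 3 * ι := by
      have h5 : β * (1 - θ) * SL ≤ β * (1 - θ / 2) ^ 2 * SL := by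
        refine mul_le_mul_of_nonneg_right (mul_le_mul_of_nonneg_left ?_ hβ0.le) hSL0
        nlinarith [sq_nonneg θ]
      have h6 := mul_le_mul_of_nonneg_left h2' (show 0 ≤ 1 - θ / 2 by linarith)
      nlinarith [mul_nonneg hθ0.le hι0]
    have e7 : 3 * ι / η * (Fintype.card A / V.tree.reach (V.tree.balanced l) l x) =
        3 * ι / β := by
      have : V.tree.reach (V.tree.balanced l) l x ≠ 0 := by
        intro e
        rw [base, e, zero_div] at hb
        exact lt_irrefl _ hb
      rw [hβ, base]
      field_simp
    rw [e7, ← sub_le_iff_le_add', le_div_iff₀ hβ0]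
    linarith
  -- There are A + 1 ≤ 2A test weights at each infoset.
  have hcard : (Fintype.card (Σ l : Fin H, X l × Option A) : ℝ) ≤ 2 * numPairs H X A := by
    have hA : 1 ≤ Fintype.card A := Fintype.card_pos
    rw [Fintype.card_sigma]
    simp only [Fintype.card_prod, Fintype.card_option]
    rw [← Finset.sum_mul, Fin.sum_univ_eq_sum_range (fun l => Fintype.card (X l)) H, numPairs]
    have : (∑ h ∈ Finset.range H, Fintype.card (X h)) * (Fintype.card A + 1) ≤
        2 * ((∑ h ∈ Finset.range H, Fintype.card (X h)) * Fintype.card A) := by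
      nlinarith [Nat.mul_le_mul_left (∑ h ∈ Finset.range H, Fintype.card (X h)) hA]
    exact_mod_cast this
  have hsub : {ω | ¬ ∀ μ', IsPolicy H μ' → ∑ t ∈ Finset.range T,
        (V.value (κ t ω) μ' - V.value (κ t ω) (V.cfrPolicy η d g t ω)) ≤
      2 * (η * H) * (T * (H : ℝ) ^ 2) + 3 * ι / η * numPairs H X A} ⊆
      {ω | ¬ ∀ t < T, ∀ l h, g t l ω h ∈ Set.Icc (0 : ℝ) 1} ∪ ⋃ p, bad p := by
    intro ω hω
    by_contra hn
    simp only [Set.mem_union, Set.mem_iUnion, not_or, not_exists, Set.mem_ofPred_eq,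
      not_not] at hn
    exact hω (hgood ω hn.1 hn.2)
  calc _ ≤ P {ω | ¬ ∀ t < T, ∀ l h, g t l ω h ∈ Set.Icc (0 : ℝ) 1} + P (⋃ p, bad p) :=
        (measure_mono hsub).trans (measure_union_le _ _)
    _ = P (⋃ p, bad p) := by rw [ae_iff.1 hgain, zero_add]
    _ ≤ ∑ p, P (bad p) := measure_iUnion_fintype_le _ _
    _ ≤ ∑ p : (Σ l : Fin H, X l × Option A), ENNReal.ofReal (Real.exp (-ι)) :=
        Finset.sum_le_sum fun p _ => hbadP p
    _ = ENNReal.ofReal (Fintype.card (Σ l : Fin H, X l × Option A) * Real.exp (-ι)) := by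
        rw [Finset.sum_const, nsmul_eq_mul, ENNReal.ofReal_mul (Nat.cast_nonneg _),
          ENNReal.ofReal_natCast, Finset.card_univ]
    _ ≤ _ := ENNReal.ofReal_le_ofReal
        (mul_le_mul_of_nonneg_right hcard (Real.exp_pos _).le)

end PlayerView

/-! ### The game as a kernel for each player. -/

namespace TreeGame

variable {H : ℕ} {S X Y : ℕ → Type*} {A B : Type*} [∀ h, Fintype (S h)]
  (G : TreeGame H S X Y A B)

section prefixes

/-- The probability of the state of step `n`, given the steps before. -/
def transition : ∀ n, GamePath n S A B → S n → ℝ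
  | 0, _, s => G.p0 s
  | n + 1, d, s => G.p n (d (Fin.last n)).1 (d (Fin.last n)).2.1 (d (Fin.last n)).2.2 s

/-- The probability of the first `n` steps. -/
def prefixProb (μ : Plan X A) (ν : Plan Y B) : ∀ n, GamePath n S A B → ℝ
  | 0, _ => 1
  | n + 1, d => prefixProb μ ν n (fun h => d h.castSucc) *
      (G.transition n (fun h => d h.castSucc) (d (Fin.last n)).1 *
        (μ n (G.x n (d (Fin.last n)).1) (d (Fin.last n)).2.1 *
          ν n (G.y n (d (Fin.last n)).1) (d (Fin.last n)).2.2))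

/-- The recursive form allows the last step to be summed out; this matches it with the products in
`pathProb`. -/
lemma prefixProb_eq (μ : Plan X A) (ν : Plan Y B) : ∀ n (d : GamePath (n + 1) S A B),
    G.prefixProb μ ν (n + 1) d = G.p0 (d 0).1 *
      (∏ h : Fin (n + 1), μ h (G.x h (d h).1) (d h).2.1 * ν h (G.y h (d h).1) (d h).2.2) *
      ∏ h : Fin n, G.p h (d h.castSucc).1 (d h.castSucc).2.1 (d h.castSucc).2.2 (d h.succ).1
  | 0, d => by
      simp [prefixProb, transition]
  | n + 1, d => by
      have e : ∀ (c : ℝ) (f : Fin (n + 2) → ℝ) (q : Fin (n + 1) → ℝ),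
          c * (∏ h : Fin (n + 1), f h.castSucc) * (∏ h : Fin n, q h.castSucc) *
            (q (Fin.last n) * f (Fin.last (n + 1))) = c * (∏ h, f h) * ∏ h, q h := by
        intro c f q
        rw [Fin.prod_univ_castSucc f, Fin.prod_univ_castSucc q]
        ring
      rw [prefixProb, prefixProb_eq μ ν n]
      exact e _ (fun h => μ h (G.x h (d h).1) (d h).2.1 * ν h (G.y h (d h).1) (d h).2.2)
        (fun h => G.p h (d h.castSucc).1 (d h.castSucc).2.1 (d h.castSucc).2.2 (d h.succ).1)

lemma prefixProb_congr {μ μ' : Plan X A} {ν ν' : Plan Y B} : ∀ {n : ℕ}, (∀ h < n, μ h = μ' h) →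
    (∀ h < n, ν h = ν' h) → G.prefixProb μ ν n = G.prefixProb μ' ν' n
  | 0, _, _ => rfl
  | n + 1, h1, h2 => by
      funext d
      rw [prefixProb, prefixProb, prefixProb_congr (fun h hh => h1 h (by omega))
        (fun h hh => h2 h (by omega)), h1 n (by omega), h2 n (by omega)]

/-- Appending one step to a path. -/
def snocEquiv (n : ℕ) (S : ℕ → Type*) (A B : Type*) :
    GamePath n S A B × (S n × A × B) ≃ GamePath (n + 1) S A B where
  toFun q := Fin.snoc (α := fun i : Fin (n + 1) => S i × A × B) q.1 q.2
  invFun d := (fun h => d h.castSucc, d (Fin.last n))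
  left_inv q := Prod.ext (Fin.init_snoc (α := fun i : Fin (n + 1) => S i × A × B) q.2 q.1)
    (Fin.snoc_last (α := fun i : Fin (n + 1) => S i × A × B) q.2 q.1)
  right_inv d := Fin.snoc_init_self d

lemma sum_transition {n : ℕ} (hn : n < H) (d : GamePath n S A B) :
    ∑ s, G.transition n d s = 1 := by
  cases n with
  | zero => exact G.p0_sum
  | succ n => exact G.p_sum n hn _ _ _

lemma pathProb_eq_prefixProb (μ : Plan X A) (ν : Plan Y B) (d : GamePath H S A B) :
    G.pathProb μ ν d = G.prefixProb μ ν H d := by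
  obtain ⟨n, rfl⟩ : ∃ n, H = n + 1 := ⟨H - 1, by have := G.H_pos; omega⟩
  rw [prefixProb_eq]
  rfl

variable [Fintype A] [Fintype B]

lemma sum_step {μ : Plan X A} {ν : Plan Y B} (hμ : IsPolicy H μ) (hν : IsPolicy H ν) {n : ℕ}
    (hn : n < H) (d : GamePath n S A B) : ∑ e : S n × A × B, G.transition n d e.1 *
      (μ n (G.x n e.1) e.2.1 * ν n (G.y n e.1) e.2.2) = 1 := by
  rw [← G.sum_transition hn d, Fintype.sum_prod_type]
  refine Finset.sum_congr rfl fun s _ => ?_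
  rw [Fintype.sum_prod_type]
  simp_rw [← Finset.mul_sum, (hν n hn (G.y n s)).2, mul_one, (hμ n hn (G.x n s)).2, mul_one]

lemma sum_prefixProb_succ {μ : Plan X A} {ν : Plan Y B} (hμ : IsPolicy H μ) (hν : IsPolicy H ν)
    {n : ℕ} (hn : n < H) (f : GamePath n S A B → ℝ) :
    ∑ d, G.prefixProb μ ν (n + 1) d * f (fun h => d h.castSucc) =
      ∑ d, G.prefixProb μ ν n d * f d := by
  rw [← (snocEquiv n S A B).sum_comp, Fintype.sum_prod_type]
  refine Finset.sum_congr rfl fun d _ => ?_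
  have h1 : ∀ e : S n × A × B, (fun h : Fin n => snocEquiv n S A B (d, e) h.castSucc) = d :=
    fun e => congrArg Prod.fst ((snocEquiv n S A B).left_inv (d, e))
  have h2 : ∀ e : S n × A × B, snocEquiv n S A B (d, e) (Fin.last n) = e :=
    fun e => congrArg Prod.snd ((snocEquiv n S A B).left_inv (d, e))
  simp_rw [prefixProb, h1, h2]
  rw [← Finset.sum_mul, ← Finset.mul_sum, G.sum_step hμ hν hn, mul_one]

lemma sum_prefixProb {μ : Plan X A} {ν : Plan Y B} (hμ : IsPolicy H μ) (hν : IsPolicy H ν)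
    {k : ℕ} (f : GamePath k S A B → ℝ) {n : ℕ} (hkn : k ≤ n) : n ≤ H →
    ∑ d : GamePath n S A B, G.prefixProb μ ν n d * f (fun h => d (h.castLE hkn)) =
      ∑ d, G.prefixProb μ ν k d * f d := by
  induction n, hkn using Nat.le_induction with
  | base => exact fun _ => rfl
  | succ n hkn ih =>
    intro hn
    rw [← ih (by omega)]
    exact G.sum_prefixProb_succ hμ hν hn fun d : GamePath n S A B => f (fun h => d (h.castLE hkn))

lemma sum_pathProb {μ : Plan X A} {ν : Plan Y B} (hμ : IsPolicy H μ) (hν : IsPolicy H ν) :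
    ∑ d, G.pathProb μ ν d = 1 := by
  simp_rw [pathProb_eq_prefixProb]
  have := G.sum_prefixProb hμ hν (fun _ : GamePath 0 S A B => 1) (Nat.zero_le H) le_rfl
  simpa [prefixProb] using this

/-- Summing out the steps after `j` leaves the law of a prefix, which involves the policies only up
to `j`. This supplies `causal` for both kernels. -/
lemma sum_pathProb_mul_congr {μ μ' : Plan X A} {ν ν' : Plan Y B} (hμ : IsPolicy H μ)
    (hν : IsPolicy H ν) (hμ' : IsPolicy H μ') (hν' : IsPolicy H ν') (j : Fin H)
    (h1 : ∀ h ≤ (j : ℕ), μ h = μ' h) (h2 : ∀ h ≤ (j : ℕ), ν h = ν' h) (f : S j × A × B → ℝ) :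
    ∑ d, G.pathProb μ ν d * f (d j) = ∑ d, G.pathProb μ' ν' d * f (d j) := by
  simp_rw [pathProb_eq_prefixProb]
  have e1 := G.sum_prefixProb hμ hν (fun d : GamePath (j + 1) S A B => f (d (Fin.last j)))
    (Nat.succ_le_of_lt j.2) le_rfl
  have e2 := G.sum_prefixProb hμ' hν' (fun d : GamePath (j + 1) S A B => f (d (Fin.last j)))
    (Nat.succ_le_of_lt j.2) le_rfl
  rw [G.prefixProb_congr (fun h hh => h1 h (Nat.le_of_lt_succ hh))
    (fun h hh => h2 h (Nat.le_of_lt_succ hh)), ← e2] at e1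
  exact e1

end prefixes

/-- The probability that chance contributes to a path. -/
def chance (d : GamePath H S A B) : ℝ :=
  G.p0 (d ⟨0, G.H_pos⟩).1 * ∏ h : Fin (H - 1), G.p h (d ⟨h, by omega⟩).1 (d ⟨h, by omega⟩).2.1
      (d ⟨h, by omega⟩).2.2 (d ⟨h + 1, by omega⟩).1

lemma chance_nonneg (d : GamePath H S A B) : 0 ≤ G.chance d :=
  mul_nonneg (G.p0_nonneg _) (Finset.prod_nonneg fun _ _ => G.p_nonneg _ _ _ _ _)

lemma par_of_chance_ne_zero {d : GamePath H S A B} (hd : G.chance d ≠ 0) (h : ℕ)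
    (hh : h + 1 < H) : G.par h (d ⟨h + 1, hh⟩).1 = d ⟨h, by omega⟩ :=
  G.par_unique _ _ _ _ _
    (Finset.prod_ne_zero_iff.1 (right_ne_zero_of_mul hd) ⟨h, by omega⟩ (Finset.mem_univ _))

/-- Transition probabilities sum to one, so some successor is charged and `par_unique` fixes its
parent. As every infoset contains a state, this yields `HasChildren`, which keeps the balanced
probabilities positive. -/
lemma exists_successor [Nonempty A] [Nonempty B] (h : ℕ) (hh : h + 1 < H) (s : S h) (a : A)
    (b : B) : ∃ s', G.par h s' = (s, a, b) := by
  by_contra hn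
  push Not at hn
  have h1 : ∀ s', G.p h s a b s' = 0 := fun s' => by
    by_contra h2
    exact hn s' (G.par_unique _ _ _ _ _ h2)
  have h3 := G.p_sum h hh s a b
  simp [h1] at h3

lemma isProbabilityMeasure_rewardLaw (d : GamePath H S A B) :
    IsProbabilityMeasure (G.rewardLaw d) := by
  have := fun h : Fin H => G.R_prob h (d h).1 (d h).2.1 (d h).2.2
  unfold rewardLaw
  infer_instance

lemma ae_reward_mem (d : GamePath H S A B) :
    ∀ᵐ r ∂(G.rewardLaw d), ∀ h, r h ∈ Set.Icc (0 : ℝ) 1 := by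
  have := fun h : Fin H => G.R_prob h (d h).1 (d h).2.1 (d h).2.2
  rw [ae_all_iff]
  intro h
  have h1 := (measurePreserving_eval
    (fun h : Fin H => G.R h (d h).1 (d h).2.1 (d h).2.2) h).quasiMeasurePreserving
  exact h1.ae (p := fun r => r ∈ Set.Icc (0 : ℝ) 1) (G.R_supp h (d h).1 (d h).2.1 (d h).2.2)

lemma integral_reward (d : GamePath H S A B) (h : Fin H) :
    ∫ r, r h ∂(G.rewardLaw d) = G.meanReward h (d h).1 (d h).2.1 (d h).2.2 := by
  have := fun h : Fin H => G.R_prob h (d h).1 (d h).2.1 (d h).2.2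
  have h1 := measurePreserving_eval (fun h : Fin H => G.R h (d h).1 (d h).2.1 (d h).2.2) h
  rw [meanReward, ← h1.map_eq]
  exact (integral_map (f := fun r : ℝ => r) h1.measurable.aemeasurable
    measurable_id.aestronglyMeasurable).symm

variable [Nonempty A] [Nonempty B]

/-- The game as seen by the max-player. -/
def maxView : PlayerView H X A (GamePath H S A B) where
  tree := G.xTree
  children h hh x a := by
    obtain ⟨s, rfl⟩ := G.x_surj h x
    obtain ⟨s', hs'⟩ := G.exists_successor h hh s a (Classical.arbitrary B)
    exact ⟨G.x (h + 1) s', by rw [G.x_recall, hs']⟩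
  info d h := G.x h (d h).1
  act d h := (d h).2.1
  gains := G.rewardLaw
  gains_prob := G.isProbabilityMeasure_rewardLaw
  gains_supp := G.ae_reward_mem

lemma measurable_one_sub : Measurable fun (r : Fin H → ℝ) h => 1 - r h :=
  measurable_pi_lambda _ fun h => measurable_const.sub (measurable_pi_apply h)

/-- The game as seen by the min-player. -/
def minView : PlayerView H Y B (GamePath H S A B) where
  tree := G.yTree
  children h hh y b := by
    obtain ⟨s, rfl⟩ := G.y_surj h y
    obtain ⟨s', hs'⟩ := G.exists_successor h hh s (Classical.arbitrary A) b
    exact ⟨G.y (h + 1) s', by rw [G.y_recall, hs']⟩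
  info d h := G.y h (d h).1
  act d h := (d h).2.2
  gains d := (G.rewardLaw d).map fun r h => 1 - r h
  gains_prob d := by
    have := G.isProbabilityMeasure_rewardLaw d
    exact Measure.isProbabilityMeasure_map measurable_one_sub.aemeasurable
  gains_supp d := by
    have hm : MeasurableSet {r : Fin H → ℝ | ∀ h, r h ∈ Set.Icc (0 : ℝ) 1} := by
      rw [Set.ofPred_forall]
      exact MeasurableSet.iInter fun h => measurable_pi_apply h measurableSet_Icc
    rw [ae_map_iff measurable_one_sub.aemeasurable hm]
    filter_upwards [G.ae_reward_mem d] with r hr h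
    constructor <;> linarith [(hr h).1, (hr h).2]

lemma maxView_meanGain (d : GamePath H S A B) (h : Fin H) :
    G.maxView.meanGain d h = G.meanReward h (d h).1 (d h).2.1 (d h).2.2 :=
  G.integral_reward d h

lemma minView_meanGain (d : GamePath H S A B) (h : Fin H) :
    G.minView.meanGain d h = 1 - G.meanReward h (d h).1 (d h).2.1 (d h).2.2 := by
  have := G.isProbabilityMeasure_rewardLaw d
  have hint : Integrable (fun r : Fin H → ℝ => r h) (G.rewardLaw d) :=
    G.maxView.integrable_gain d h
  change ∫ g, g h ∂((G.rewardLaw d).map fun r h => 1 - r h) = _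
  rw [integral_map measurable_one_sub.aemeasurable
    (measurable_pi_apply h).aestronglyMeasurable, integral_sub (integrable_const _) hint,
    G.integral_reward]
  simp

/-- Chance and the two players contribute separate factors; grouping chance with the opponent gives
the kernel that a player faces. -/
lemma pathProb_eq (μ : Plan X A) (ν : Plan Y B) (d : GamePath H S A B) :
    G.pathProb μ ν d = G.chance d * G.maxView.weight μ d * G.minView.weight ν d := by
  unfold pathProb chance PlayerView.weight
  rw [Finset.prod_mul_distrib]
  simp only [maxView, minView]
  ring

lemma maxView_consistent {d : GamePath H S A B} (hd : G.chance d ≠ 0) :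
    G.maxView.Consistent d := fun h hh => by
  change G.xTree.par h (G.x (h + 1) (d ⟨h + 1, hh⟩).1) = _
  rw [G.x_recall, G.par_of_chance_ne_zero hd h hh]
  rfl

lemma minView_consistent {d : GamePath H S A B} (hd : G.chance d ≠ 0) :
    G.minView.Consistent d := fun h hh => by
  change G.yTree.par h (G.y (h + 1) (d ⟨h + 1, hh⟩).1) = _
  rw [G.y_recall, G.par_of_chance_ne_zero hd h hh]
  rfl

/-- The kernel that the max-player faces against `ν`. -/
def maxKernel (ν : Plan Y B) (d : GamePath H S A B) : ℝ := G.chance d * G.minView.weight ν d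

/-- The kernel that the min-player faces against `μ`. -/
def minKernel (μ : Plan X A) (d : GamePath H S A B) : ℝ := G.chance d * G.maxView.weight μ d

lemma maxKernel_mul_weight (μ : Plan X A) (ν : Plan Y B) (d : GamePath H S A B) :
    G.maxKernel ν d * G.maxView.weight μ d = G.pathProb μ ν d := by
  rw [pathProb_eq, maxKernel]; ring

lemma minKernel_mul_weight (μ : Plan X A) (ν : Plan Y B) (d : GamePath H S A B) :
    G.minKernel μ d * G.minView.weight ν d = G.pathProb μ ν d := by
  rw [pathProb_eq, minKernel]

variable [Fintype A] [Fintype B]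

lemma isKernel_maxKernel {ν : Plan Y B} (hν : IsPolicy H ν) :
    G.maxView.IsKernel (G.maxKernel ν) where
  nonneg d := mul_nonneg (G.chance_nonneg d) (G.minView.weight_nonneg hν d)
  perfect_recall d hd := G.maxView_consistent (left_ne_zero_of_mul hd)
  sum_eq_one μ hμ := by
    simp_rw [maxKernel_mul_weight]
    exact G.sum_pathProb hμ hν
  causal μ μ' hμ hμ' j hj := by
    simp_rw [maxKernel_mul_weight, maxView_meanGain]
    exact G.sum_pathProb_mul_congr hμ hν hμ' hν j hj (fun _ _ => rfl)
      fun e => G.meanReward j e.1 e.2.1 e.2.2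

lemma isKernel_minKernel {μ : Plan X A} (hμ : IsPolicy H μ) :
    G.minView.IsKernel (G.minKernel μ) where
  nonneg d := mul_nonneg (G.chance_nonneg d) (G.maxView.weight_nonneg hμ d)
  perfect_recall d hd := G.minView_consistent (left_ne_zero_of_mul hd)
  sum_eq_one ν hν := by
    simp_rw [minKernel_mul_weight]
    exact G.sum_pathProb hμ hν
  causal ν ν' hν hν' j hj := by
    simp_rw [minKernel_mul_weight, minView_meanGain]
    exact G.sum_pathProb_mul_congr hμ hν hμ hν' j (fun _ _ => rfl) hj
      fun e => 1 - G.meanReward j e.1 e.2.1 e.2.2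

lemma maxView_value (μ : Plan X A) (ν : Plan Y B) :
    G.maxView.value (G.maxKernel ν) μ = G.value μ ν := by
  unfold PlayerView.value value
  simp_rw [maxKernel_mul_weight, maxView_meanGain]

lemma minView_value {μ : Plan X A} {ν : Plan Y B} (hμ : IsPolicy H μ) (hν : IsPolicy H ν) :
    G.minView.value (G.minKernel μ) ν = H - G.value μ ν := by
  unfold PlayerView.value value
  simp_rw [minKernel_mul_weight, minView_meanGain, Finset.sum_sub_distrib, mul_sub,
    Finset.sum_sub_distrib, ← Finset.sum_mul, G.sum_pathProb hμ hν]
  simp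

lemma value_mem {μ : Plan X A} {ν : Plan Y B} (hμ : IsPolicy H μ) (hν : IsPolicy H ν) :
    G.value μ ν ∈ Set.Icc (0 : ℝ) H := by
  have h0 : ∀ d, 0 ≤ G.pathProb μ ν d := fun d => by
    rw [← maxKernel_mul_weight]
    exact mul_nonneg ((G.isKernel_maxKernel hν).nonneg d) (G.maxView.weight_nonneg hμ d)
  constructor
  · refine Finset.sum_nonneg fun d _ => mul_nonneg (h0 d) (Finset.sum_nonneg fun h _ => ?_)
    rw [← maxView_meanGain]
    exact G.maxView.meanGain_nonneg d h
  · calc G.value μ ν ≤ ∑ d, G.pathProb μ ν d * H := by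
          refine Finset.sum_le_sum fun d _ => mul_le_mul_of_nonneg_left ?_ (h0 d)
          calc _ ≤ ∑ h : Fin H, (1 : ℝ) := by
                refine Finset.sum_le_sum fun h _ => ?_
                rw [← maxView_meanGain]
                exact G.maxView.meanGain_le_one d h
            _ = H := by simp
      _ = H := by rw [← Finset.sum_mul, G.sum_pathProb hμ hν, one_mul]

end TreeGame

/-! ### Averaging in sequence form. -/

section average

variable {X : ℕ → Type*} {A : Type*} (I : InfoTree X A) {T : ℕ} {μ : ℕ → Plan X A}

/-- The denominator of each conditional probability cancels the averaged reach of its infoset, so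
the product telescopes. Positivity, which Hedge guarantees, excludes 0/0. -/
lemma InfoTree.reach_average (hT : 0 < T) (hμ : ∀ t h x a, 0 < μ t h x a) :
    ∀ h (x : X h), I.reach (I.average T μ) h x = (∑ t ∈ Finset.range T, I.reach (μ t) h x) / T
  | 0, x => by
      have : (T : ℝ) ≠ 0 := by exact_mod_cast hT.ne'
      simp [InfoTree.reach, this]
  | h + 1, x => by
      have h1 : 0 < ∑ t ∈ Finset.range T, I.reach (μ t) h (I.par h x).1 :=
        Finset.sum_pos (fun t _ => I.reach_pos (H := h) (fun h _ => hμ t h) le_rfl _)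
          (Finset.nonempty_range_iff.2 hT.ne')
      simp only [InfoTree.reach]
      rw [InfoTree.reach_average hT hμ h, InfoTree.average]
      simp only [InfoTree.seqForm]
      field_simp

lemma InfoTree.seqForm_average (hT : 0 < T) (hμ : ∀ t h x a, 0 < μ t h x a) (h : ℕ) (x : X h)
    (a : A) : I.seqForm (I.average T μ) h x a =
      (∑ t ∈ Finset.range T, I.seqForm (μ t) h x a) / T := by
  have h1 : 0 < ∑ t ∈ Finset.range T, I.reach (μ t) h x :=
    Finset.sum_pos (fun t _ => I.reach_pos (H := h) (fun h _ => hμ t h) le_rfl _)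
      (Finset.nonempty_range_iff.2 hT.ne')
  rw [InfoTree.seqForm, I.reach_average hT hμ, InfoTree.average]
  field_simp

lemma InfoTree.isPolicy_average [Fintype A] {H : ℕ} (hT : 0 < T)
    (hμ : ∀ t h x a, 0 < μ t h x a) (hpol : ∀ t, IsPolicy H (μ t)) :
    IsPolicy H (I.average T μ) := by
  intro h hh x
  have h1 : 0 < ∑ t ∈ Finset.range T, I.reach (μ t) h x :=
    Finset.sum_pos (fun t _ => I.reach_pos (H := h) (fun h _ => hμ t h) le_rfl _)
      (Finset.nonempty_range_iff.2 hT.ne')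
  refine ⟨fun a => div_nonneg (Finset.sum_nonneg fun t _ =>
    I.seqForm_nonneg (hpol t) hh x a) h1.le, ?_⟩
  unfold InfoTree.average
  rw [← Finset.sum_div, Finset.sum_comm]
  simp_rw [I.sum_seqForm (hpol _) hh]
  exact div_self h1.ne'

lemma PlayerView.Consistent.weight_average {H : ℕ} {D : Type*} {V : PlayerView H X A D} {d : D}
    (hd : V.Consistent d) (hH : 0 < H) (hT : 0 < T) (hμ : ∀ t h x a, 0 < μ t h x a) :
    V.weight (V.tree.average T μ) d = (∑ t ∈ Finset.range T, V.weight (μ t) d) / T := by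
  -- No factor remains after the last step, so the weight of a path is a single sequence-form value
  -- and averages linearly.
  set l : Fin H := ⟨H - 1, by omega⟩ with hl
  have h1 : Finset.Ioi l = ∅ := by
    ext h
    simp only [Finset.mem_Ioi, Fin.lt_def, hl, Finset.notMem_empty, iff_false]
    omega
  have h2 : ∀ π : Plan X A, V.weight π d = V.tree.seqForm π l (V.info d l) (V.act d l) :=
    fun π => by rw [hd.weight_eq π l, h1, Finset.prod_empty, mul_one]
  simp_rw [h2]
  exact V.tree.seqForm_average hT hμ _ _ _

end average

namespace TreeGame

variable {H : ℕ} {S X Y : ℕ → Type*} {A B : Type*} [∀ h, Fintype (S h)]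
  (G : TreeGame H S X Y A B) [Fintype A] [Fintype B] [Nonempty A] [Nonempty B] {T : ℕ}

lemma value_average_right (hT : 0 < T) {ν : ℕ → Plan Y B} (hν : ∀ t h y b, 0 < ν t h y b)
    (μ : Plan X A) :
    G.value μ (G.yTree.average T ν) * T = ∑ t ∈ Finset.range T, G.value μ (ν t) := by
  have hT' : (T : ℝ) ≠ 0 := by exact_mod_cast hT.ne'
  unfold value
  rw [Finset.sum_mul, Finset.sum_comm]
  refine Finset.sum_congr rfl fun d _ => ?_
  rw [← Finset.sum_mul]
  simp_rw [pathProb_eq]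
  -- Paths that chance excludes may violate perfect recall, but they contribute nothing to the
  -- value.
  by_cases hd : G.chance d = 0
  · simp [hd]
  · have h1 := (G.minView_consistent hd).weight_average G.H_pos hT hν
    change G.minView.weight (G.yTree.average T ν) d = _ at h1
    rw [h1, ← Finset.mul_sum]
    field_simp

lemma value_average_left (hT : 0 < T) {μ : ℕ → Plan X A} (hμ : ∀ t h x a, 0 < μ t h x a)
    (ν : Plan Y B) :
    G.value (G.xTree.average T μ) ν * T = ∑ t ∈ Finset.range T, G.value (μ t) ν := by
  have hT' : (T : ℝ) ≠ 0 := by exact_mod_cast hT.ne'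
  unfold value
  rw [Finset.sum_mul, Finset.sum_comm]
  refine Finset.sum_congr rfl fun d _ => ?_
  rw [← Finset.sum_mul]
  simp_rw [pathProb_eq]
  by_cases hd : G.chance d = 0
  · simp [hd]
  · have h1 := (G.maxView_consistent hd).weight_average G.H_pos hT hμ
    change G.maxView.weight (G.xTree.average T μ) d = _ at h1
    rw [h1, ← Finset.sum_mul, ← Finset.mul_sum]
    field_simp

end TreeGame

/-! ### Order of episodes, and self-play as a run for each player. -/

lemma minEpisode_lt_maxEpisode {H s t l : ℕ} (hs : s < t) (hl : l < H) (l' : ℕ) :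
    minEpisode H s l < maxEpisode H t l' := by
  have h1 : 2 * H * (s + 1) ≤ 2 * H * t := Nat.mul_le_mul_left _ hs
  have h2 : 2 * H * (s + 1) = 2 * H * s + H + H := by ring
  unfold minEpisode maxEpisode
  omega

lemma maxEpisode_lt_minEpisode {H s t l : ℕ} (hs : s ≤ t) (hl : l < H) (l' : ℕ) :
    maxEpisode H s l < minEpisode H t l' := by
  have h1 : 2 * H * s ≤ 2 * H * t := Nat.mul_le_mul_left _ hs
  unfold minEpisode maxEpisode
  omega

lemma minEpisode_lt_minEpisode {H s t l : ℕ} (hs : s < t) (hl : l < H) (l' : ℕ) :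
    minEpisode H s l < minEpisode H t l' := by
  have := minEpisode_lt_maxEpisode hs hl l'
  unfold minEpisode maxEpisode at *
  omega

lemma maxEpisode_lt_maxEpisode {H s t l : ℕ} (hs : s < t) (hl : l < H) (l' : ℕ) :
    maxEpisode H s l < maxEpisode H t l' :=
  lt_of_le_of_lt (by unfold maxEpisode minEpisode; omega) (minEpisode_lt_maxEpisode hs hl l')

lemma minEpisode_lt_numEpisodes {H T t l : ℕ} (ht : t < T) (hl : l < H) :
    minEpisode H t l < numEpisodes H T := minEpisode_lt_maxEpisode ht hl 0

lemma maxEpisode_lt_numEpisodes {H T t l : ℕ} (ht : t < T) (hl : l < H) :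
    maxEpisode H t l < numEpisodes H T := maxEpisode_lt_maxEpisode ht hl 0

lemma card_le_numPairs {X : ℕ → Type*} {A : Type*} [∀ h, Fintype (X h)] [Fintype A] {H : ℕ}
    (hH : 0 < H) (x : X 0) : Fintype.card A ≤ numPairs H X A :=
  Nat.le_mul_of_pos_left _ ((Fintype.card_pos_iff.2 ⟨x⟩).trans_le (Finset.single_le_sum
    (f := fun h => Fintype.card (X h)) (fun _ _ => Nat.zero_le _) (Finset.mem_range.2 hH)))

lemma TreeGame.exists_initial {H : ℕ} {S X Y : ℕ → Type*} {A B : Type*} [∀ h, Fintype (S h)]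
    (G : TreeGame H S X Y A B) : Nonempty (S 0) := by
  by_contra hn
  rw [not_nonempty_iff] at hn
  have := G.p0_sum
  simp at this

namespace TreeGame

section policies

variable {H : ℕ} {S X Y : ℕ → Type*} {A B : Type*} [∀ h, Fintype (S h)]
  (G : TreeGame H S X Y A B)

section

variable [Fintype A] [Nonempty A]

lemma maxPolicy_pos (η : ℝ) (d : ℕ → GamePath H S A B) (r : ℕ → Fin H → ℝ) (t h : ℕ) (x : X h)
    (a : A) : 0 < G.maxPolicy η d r t h x a := G.xTree.balancedCFR_pos _ _ _ _ _ _

lemma isPolicy_maxPolicy (η : ℝ) (d : ℕ → GamePath H S A B) (r : ℕ → Fin H → ℝ) (t : ℕ) :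
    IsPolicy H (G.maxPolicy η d r t) := G.xTree.isPolicy_balancedCFR _ _ _

end

section

variable [Fintype B] [Nonempty B]

lemma minPolicy_pos (η : ℝ) (d : ℕ → GamePath H S A B) (r : ℕ → Fin H → ℝ) (t h : ℕ) (y : Y h)
    (b : B) : 0 < G.minPolicy η d r t h y b := G.yTree.balancedCFR_pos _ _ _ _ _ _

lemma isPolicy_minPolicy (η : ℝ) (d : ℕ → GamePath H S A B) (r : ℕ → Fin H → ℝ) (t : ℕ) :
    IsPolicy H (G.minPolicy η d r t) := G.yTree.isPolicy_balancedCFR _ _ _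

end

variable [Fintype A] [Fintype B]

/-- Bounding a supremum above and an infimum below needs only nonempty index sets; attainment plays
no role. -/
lemma isApproxNash_of_le {ε : ℝ} {μ : Plan X A} {ν : Plan Y B} (hμ : IsPolicy H μ)
    (hν : IsPolicy H ν)
    (h : ∀ μ' ν', IsPolicy H μ' → IsPolicy H ν' → G.value μ' ν - G.value μ ν' ≤ ε) :
    G.IsApproxNash ε μ ν := by
  refine ⟨hμ, hν, ?_⟩
  have : Nonempty {μ' : Plan X A // IsPolicy H μ'} := ⟨⟨μ, hμ⟩⟩
  have : Nonempty {ν' : Plan Y B // IsPolicy H ν'} := ⟨⟨ν, hν⟩⟩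
  have h1 : ∀ ν' : {ν' : Plan Y B // IsPolicy H ν'},
      (⨆ μ' : {μ' : Plan X A // IsPolicy H μ'}, G.value μ' ν) - ε ≤ G.value μ ν' := fun ν' => by
    rw [sub_le_iff_le_add']
    exact ciSup_le fun μ' => by linarith [h μ' ν' μ'.2 ν'.2]
  have h2 := le_ciInf h1
  unfold NEGap
  linarith

variable {G} {Ω : Type*} [mΩ : MeasurableSpace Ω] {P : Measure Ω} {ℱ : Filtration ℕ mΩ}
  {ηX ηY : ℝ} {T : ℕ} {d : ℕ → Ω → GamePath H S A B} {r : ℕ → Ω → Fin H → ℝ}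

lemma IsSelfPlay.path_of_lt (h : G.IsSelfPlay P ℱ ηX ηY T d r) {e e' : ℕ}
    (he : e < numEpisodes H T) (hee : e < e') (d₀ : GamePath H S A B) :
    MeasurableSet[ℱ e'] {ω | d e ω = d₀} :=
  ℱ.mono (Nat.succ_le_of_lt hee) _ (h.path_measurable e he d₀)

lemma IsSelfPlay.reward_of_lt (h : G.IsSelfPlay P ℱ ηX ηY T d r) {e e' : ℕ}
    (he : e < numEpisodes H T) (hee : e < e') : Measurable[ℱ e'] (r e) :=
  (h.reward_measurable e he).mono (ℱ.mono (Nat.succ_le_of_lt hee)) le_rfl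

lemma IsSelfPlay.one_sub_reward_of_lt (h : G.IsSelfPlay P ℱ ηX ηY T d r) {e e' : ℕ}
    (he : e < numEpisodes H T) (hee : e < e') : Measurable[ℱ e'] fun ω k => 1 - r e ω k :=
  measurable_one_sub.comp (h.reward_of_lt he hee)

end policies

variable {H : ℕ} {S X Y : ℕ → Type*} {A B : Type*} [∀ h, Fintype (S h)]
  {G : TreeGame H S X Y A B} [Fintype A] [Fintype B] [Nonempty A] [Nonempty B]
  {Ω : Type*} [mΩ : MeasurableSpace Ω] {P : Measure Ω} {ℱ : Filtration ℕ mΩ} {ηX ηY : ℝ} {T : ℕ}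
  {d : ℕ → Ω → GamePath H S A B} {r : ℕ → Ω → Fin H → ℝ}

lemma IsSelfPlay.measurable_maxPolicy (h : G.IsSelfPlay P ℱ ηX ηY T d r) {t e : ℕ} (ht : t ≤ T)
    (he : ∀ s < t, ∀ l < H, maxEpisode H s l < e) (k : ℕ) (x : X k) (a : A) :
    Measurable[ℱ e] fun ω => G.maxPolicy ηX (fun e => d e ω) (fun e => r e ω) t k x a := by
  have h1 : ∀ s < t, ∀ (l : Fin H) d₀, MeasurableSet[ℱ e] {ω | d (maxEpisode H s l) ω = d₀} :=
    fun s hs l d₀ => h.path_of_lt (maxEpisode_lt_numEpisodes (by omega) l.2) (he s hs l l.2) d₀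
  have h2 : ∀ s < t, ∀ (l : Fin H), Measurable[ℱ e] (r (maxEpisode H s l)) :=
    fun s hs l => h.reward_of_lt (maxEpisode_lt_numEpisodes (by omega) l.2) (he s hs l l.2)
  exact @PlayerView.measurable_cfrPolicy H X A _ G.maxView _ Ω _ (ℱ e) ηX
    (fun t l => d (maxEpisode H t l)) (fun t l => r (maxEpisode H t l)) t h1 h2 k x a

lemma IsSelfPlay.measurable_minPolicy (h : G.IsSelfPlay P ℱ ηX ηY T d r) {t e : ℕ} (ht : t ≤ T)
    (he : ∀ s < t, ∀ l < H, minEpisode H s l < e) (k : ℕ) (y : Y k) (b : B) :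
    Measurable[ℱ e] fun ω => G.minPolicy ηY (fun e => d e ω) (fun e => r e ω) t k y b := by
  have h1 : ∀ s < t, ∀ (l : Fin H) d₀, MeasurableSet[ℱ e] {ω | d (minEpisode H s l) ω = d₀} :=
    fun s hs l d₀ => h.path_of_lt (minEpisode_lt_numEpisodes (by omega) l.2) (he s hs l l.2) d₀
  have h2 : ∀ s < t, ∀ (l : Fin H),
      Measurable[ℱ e] fun ω k => 1 - r (minEpisode H s l) ω k := fun s hs l =>
    h.one_sub_reward_of_lt (minEpisode_lt_numEpisodes (by omega) l.2) (he s hs l l.2)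
  exact @PlayerView.measurable_cfrPolicy H Y B _ G.minView _ Ω _ (ℱ e) ηY
    (fun t l => d (minEpisode H t l)) (fun t l ω k => 1 - r (minEpisode H t l) ω k) t h1 h2 k y b

/-- The opponent's policy of round `t` is computed from rounds before `t` only, hence is known
before each of the player's episodes of round `t`: the kernel is predictable although the opponent
learns too. -/
lemma IsSelfPlay.isRun_max (h : G.IsSelfPlay P ℱ ηX ηY T d r) :
    G.maxView.IsRun P (fun t l => ℱ (maxEpisode H t l)) ηX T
      (fun t ω => G.maxKernel (G.minPolicy ηY (fun e => d e ω) (fun e => r e ω) t))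
      (fun t l => d (maxEpisode H t l)) (fun t l => r (maxEpisode H t l)) where
  le t _ l := ℱ.le _
  mono t _ s hs l := ℱ.mono (maxEpisode_lt_maxEpisode hs l.2 _).le
  path_past t ht s hs l l' d₀ := h.path_of_lt (maxEpisode_lt_numEpisodes (by omega) l'.2)
    (maxEpisode_lt_maxEpisode hs l'.2 _) d₀
  gain_past t ht s hs l l' := h.reward_of_lt (maxEpisode_lt_numEpisodes (by omega) l'.2)
    (maxEpisode_lt_maxEpisode hs l'.2 _)
  path_measurable t ht l d₀ := ℱ.le _ _
    (h.path_measurable _ (maxEpisode_lt_numEpisodes ht l.2) d₀)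
  gain_measurable t ht l :=
    (h.reward_measurable _ (maxEpisode_lt_numEpisodes ht l.2)).mono (ℱ.le _) le_rfl
  kernel t _ ω := G.isKernel_maxKernel (G.isPolicy_minPolicy _ _ _ _)
  kernel_measurable t ht l d₀ := by
    refine Measurable.const_mul (Finset.measurable_fun_prod _ fun k _ => ?_) _
    exact h.measurable_minPolicy ht.le (fun s hs l' hl' => minEpisode_lt_maxEpisode hs hl' l) k _ _
  episode t ht l E hE d₀ F hF := by
    simp_rw [maxKernel_mul_weight]
    exact h.max_episode t ht l l.2 E hE d₀ F hF

lemma IsSelfPlay.isRun_min (h : G.IsSelfPlay P ℱ ηX ηY T d r) :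
    G.minView.IsRun P (fun t l => ℱ (minEpisode H t l)) ηY T
      (fun t ω => G.minKernel (G.maxPolicy ηX (fun e => d e ω) (fun e => r e ω) t))
      (fun t l => d (minEpisode H t l)) (fun t l ω k => 1 - r (minEpisode H t l) ω k) where
  le t _ l := ℱ.le _
  mono t _ s hs l := ℱ.mono (minEpisode_lt_minEpisode hs l.2 _).le
  path_past t ht s hs l l' d₀ := h.path_of_lt (minEpisode_lt_numEpisodes (by omega) l'.2)
    (minEpisode_lt_minEpisode hs l'.2 _) d₀
  gain_past t ht s hs l l' := h.one_sub_reward_of_lt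
    (minEpisode_lt_numEpisodes (by omega) l'.2) (minEpisode_lt_minEpisode hs l'.2 _)
  path_measurable t ht l d₀ := ℱ.le _ _
    (h.path_measurable _ (minEpisode_lt_numEpisodes ht l.2) d₀)
  gain_measurable t ht l := measurable_one_sub.comp
    ((h.reward_measurable _ (minEpisode_lt_numEpisodes ht l.2)).mono (ℱ.le _) le_rfl)
  kernel t _ ω := G.isKernel_minKernel (G.isPolicy_maxPolicy _ _ _ _)
  kernel_measurable t ht l d₀ := by
    refine Measurable.const_mul (Finset.measurable_fun_prod _ fun k _ => ?_) _
    exact h.measurable_maxPolicy ht.le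
      (fun s hs l' hl' => maxEpisode_lt_minEpisode hs.le hl' l) k _ _
  episode t ht l E hE d₀ F hF := by
    simp_rw [minKernel_mul_weight]
    -- An event for the gains 1 − r is pulled back to an event for the rewards.
    have h1 := h.min_episode t ht l l.2 E hE d₀ _ (measurable_one_sub hF)
    change _ = ((G.rewardLaw d₀).map fun r h => 1 - r h) F * _
    rw [Measure.map_apply measurable_one_sub hF]
    exact h1

end TreeGame

/-! ### Choice of the learning rate and the final estimate. -/

/-- The regret bound for the learning rate of Balanced CFR with Hedge. -/
lemma regret_bound_le {H T n ι K : ℝ} (hH : 1 ≤ H) (hT : 0 < T) (hn : 0 < n) (hι : 0 < ι)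
    (hK : n * ι ≤ K) (hKT : K ≤ H * T) :
    0 < √(n * ι / (H ^ 3 * T)) ∧ √(n * ι / (H ^ 3 * T)) * H ≤ 1 ∧
      ∃ R, 0 ≤ R ∧ R ^ 2 = H ^ 3 * T * (n * ι) ∧
        2 * (√(n * ι / (H ^ 3 * T)) * H) * (T * H ^ 2) +
          3 * ι / √(n * ι / (H ^ 3 * T)) * n = 5 * R := by
  set η := √(n * ι / (H ^ 3 * T)) with hη
  have hH0 : 0 < H := by linarith
  have hq : 0 < n * ι / (H ^ 3 * T) := by positivity
  have hη0 : 0 < η := Real.sqrt_pos.2 hq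
  have hη2 : η ^ 2 * (H ^ 3 * T) = n * ι := by
    rw [hη, Real.sq_sqrt hq.le]
    field_simp
  -- This η balances the two error terms: they are 2 and 3 times R = ηH³T.
  refine ⟨hη0, ?_, η * (H ^ 3 * T), by positivity, ?_, ?_⟩
  · have h1 : (η * H) ^ 2 ≤ 1 := by
      have h2 : (η * H) ^ 2 * (H * T) ≤ 1 * (H * T) := by
        calc (η * H) ^ 2 * (H * T) = η ^ 2 * (H ^ 3 * T) := by ring
          _ ≤ 1 * (H * T) := by rw [hη2]; linarith
      exact le_of_mul_le_mul_right h2 (by positivity)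
    exact (sq_le_one_iff₀ (by positivity)).1 h1
  · rw [← hη2]; ring
  · have h3 : 3 * ι / η * n = 3 * (η * (H ^ 3 * T)) := by
      rw [div_mul_eq_mul_div, div_eq_iff hη0.ne']
      linear_combination -3 * hη2
    rw [h3]
    ring

lemma two_mul_exp_neg_le {n δ ι : ℝ} (hn : 0 < n) (hδ : 0 < δ)
    (hι : Real.log (10 * n / δ) ≤ ι) : 2 * n * Real.exp (-ι) ≤ δ / 5 := by
  have h1 : 0 < 10 * n / δ := by positivity
  have h2 : Real.exp (-ι) ≤ (10 * n / δ)⁻¹ := by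
    rw [← Real.exp_log h1, ← Real.exp_neg]
    exact Real.exp_le_exp.2 (neg_le_neg hι)
  calc 2 * n * Real.exp (-ι) ≤ 2 * n * (10 * n / δ)⁻¹ :=
        mul_le_mul_of_nonneg_left h2 (by positivity)
    _ = δ / 5 := by field_simp; norm_num

/-- The space is covered by the good set and the two failure sets, so subadditivity suffices and no
measurability of these sets is needed. -/
lemma ofReal_one_sub_le_measure {Ω : Type*} [MeasurableSpace Ω] {P : Measure Ω}
    [IsProbabilityMeasure P] {δ : ℝ} (hδ : 0 ≤ δ) {p q good : Ω → Prop}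
    (hp : P {ω | ¬ p ω} ≤ ENNReal.ofReal (δ / 5)) (hq : P {ω | ¬ q ω} ≤ ENNReal.ofReal (δ / 5))
    (h : ∀ ω, p ω → q ω → good ω) : ENNReal.ofReal (1 - δ) ≤ P {ω | good ω} := by
  have hcover : Set.univ ⊆ {ω | good ω} ∪ ({ω | ¬ p ω} ∪ {ω | ¬ q ω}) := by
    intro ω _
    by_contra hn
    simp only [Set.mem_union, Set.mem_ofPred_eq, not_or, not_not] at hn
    exact hn.1 (h ω hn.2.1 hn.2.2)
  rw [ENNReal.ofReal_sub _ hδ, ENNReal.ofReal_one]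
  refine tsub_le_iff_right.2 ?_
  calc (1 : ENNReal) = P Set.univ := measure_univ.symm
    _ ≤ P {ω | good ω} + (P {ω | ¬ p ω} + P {ω | ¬ q ω}) := (measure_mono hcover).trans
        ((measure_union_le _ _).trans (add_le_add_right (measure_union_le _ _) _))
    _ ≤ P {ω | good ω} + (ENNReal.ofReal (δ / 5) + ENNReal.ofReal (δ / 5)) := by gcongr
    _ ≤ P {ω | good ω} + ENNReal.ofReal δ := by
        rw [← ENNReal.ofReal_add (by positivity) (by positivity)]
        gcongr
        linarith

end

theorem corollary5 :
    ∃ C C' : ℝ, 0 < C ∧ 0 < C' ∧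
      ∀ (H : ℕ) (S X Y : ℕ → Type*) (A B : Type*)
        [∀ h, Fintype (S h)] [∀ h, Fintype (X h)] [∀ h, Fintype (Y h)]
        [Fintype A] [Fintype B] [Nonempty A] [Nonempty B]
        (G : TreeGame H S X Y A B) (ε δ ι : ℝ),
        0 < ε → 0 < δ → δ < 1 →
        ι = Real.log (10 * ((numPairs H X A : ℝ) + numPairs H Y B) / δ) →
        -- every sufficiently large number of rounds gives an approximate Nash equilibrium
        (∀ (T : ℕ) (ιX ιY ηX ηY : ℝ),
          ιX ∈ Set.Icc (Real.log (10 * (numPairs H X A : ℝ) / δ)) ι →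
          ιY ∈ Set.Icc (Real.log (10 * (numPairs H Y B : ℝ) / δ)) ι →
          ηX = √((numPairs H X A : ℝ) * ιX / ((H : ℝ) ^ 3 * T)) →
          ηY = √((numPairs H Y B : ℝ) * ιY / ((H : ℝ) ^ 3 * T)) →
          C * ((H : ℝ) ^ 3 * ((numPairs H X A : ℝ) + numPairs H Y B) * ι / ε ^ 2) ≤ T →
          ∀ (Ω : Type*) [mΩ : MeasurableSpace Ω] (P : Measure Ω) [IsProbabilityMeasure P]
            (ℱ : Filtration ℕ mΩ) (d : ℕ → Ω → GamePath H S A B) (r : ℕ → Ω → Fin H → ℝ),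
            G.IsSelfPlay P ℱ ηX ηY T d r →
            ENNReal.ofReal (1 - δ) ≤ P {ω | G.IsApproxNash ε
              (G.xTree.average T (G.maxPolicy ηX (fun e => d e ω) (fun e => r e ω)))
              (G.yTree.average T (G.minPolicy ηY (fun e => d e ω) (fun e => r e ω)))}) ∧
        -- the total number of episodes for the smallest such number of rounds
        (ε ≤ H →
          (numEpisodes H
            ⌈C * ((H : ℝ) ^ 3 * ((numPairs H X A : ℝ) + numPairs H Y B) * ι / ε ^ 2)⌉₊ : ℝ) ≤
          C' * ((H : ℝ) ^ 4 * ((numPairs H X A : ℝ) + numPairs H Y B) * ι / ε ^ 2)) := by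
  -- 50 comes from (5R₁ + 5R₂)² ≤ 50(R₁² + R₂²). For ε ≤ H the quantity multiplied by 50 is at least
  -- 1, so rounding up costs at most one more multiple of it, and 102 = 2 · 51.
  refine ⟨50, 102, by norm_num, by norm_num, ?_⟩
  intro H S X Y A B _ _ _ _ _ _ _ G ε δ ι hε hδ hδ1 hι
  obtain ⟨s₀⟩ := G.exists_initial
  have hH : (1 : ℝ) ≤ H := by exact_mod_cast G.H_pos
  have hcA : (1 : ℝ) ≤ Fintype.card A := by exact_mod_cast Fintype.card_pos
  have hcB : (1 : ℝ) ≤ Fintype.card B := by exact_mod_cast Fintype.card_pos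
  have hnA : (Fintype.card A : ℝ) ≤ numPairs H X A := by exact_mod_cast card_le_numPairs G.H_pos (G.x 0 s₀)
  have hnB : (Fintype.card B : ℝ) ≤ numPairs H Y B := by exact_mod_cast card_le_numPairs G.H_pos (G.y 0 s₀)
  generalize hnX : (numPairs H X A : ℝ) = nX at *
  generalize hnY : (numPairs H Y B : ℝ) = nY at *
  have hlog : ∀ {c n : ℝ}, 1 ≤ c → c ≤ n → Real.log c ≤ Real.log (10 * n / δ) ∧
      1 ≤ Real.log (10 * n / δ) := by
    intro c n hc hcn
    have h1 : 10 * n ≤ 10 * n / δ := by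
      rw [le_div_iff₀ hδ]
      nlinarith
    constructor
    · exact Real.log_le_log (by linarith) (by linarith)
    · rw [Real.le_log_iff_exp_le (by linarith)]
      linarith [Real.exp_one_lt_d9]
  have hι1 : 1 ≤ ι := by
    rw [hι]
    exact (hlog le_rfl (show (1 : ℝ) ≤ nX + nY by linarith)).2
  have hn0 : 0 < nX + nY := by linarith
  constructor
  · intro T ιX ιY ηX ηY hιX hιY hηX hηY hT Ω _ P _ ℱ d r hplay
    have hT0' : (0 : ℝ) < T := lt_of_lt_of_le (by positivity) hT
    have hT0 : 0 < T := by exact_mod_cast hT0'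
    have hpX : ∀ ω, IsPolicy H
        (G.xTree.average T (G.maxPolicy ηX (fun e => d e ω) (fun e => r e ω))) := fun ω =>
      G.xTree.isPolicy_average hT0 (G.maxPolicy_pos _ _ _) (G.isPolicy_maxPolicy _ _ _)
    have hpY : ∀ ω, IsPolicy H
        (G.yTree.average T (G.minPolicy ηY (fun e => d e ω) (fun e => r e ω))) := fun ω =>
      G.yTree.isPolicy_average hT0 (G.minPolicy_pos _ _ _) (G.isPolicy_minPolicy _ _ _)
    -- All values lie in [0, H], so ε > H is trivial. In the other case ε ≤ H makes `T` large enough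
    -- for ηH ≤ 1, through `hKT`.
    rcases lt_or_ge (H : ℝ) ε with hεH | hεH
    · have hall : {ω | G.IsApproxNash ε
          (G.xTree.average T (G.maxPolicy ηX (fun e => d e ω) (fun e => r e ω)))
          (G.yTree.average T (G.minPolicy ηY (fun e => d e ω) (fun e => r e ω)))} =
          Set.univ := by
        refine Set.eq_univ_of_forall fun ω => G.isApproxNash_of_le (hpX ω) (hpY ω)
          fun μ' ν' hμ' hν' => ?_
        linarith [(G.value_mem hμ' (hpY ω)).2, (G.value_mem (hpX ω) hν').1]
      rw [hall, measure_univ]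
      exact ENNReal.ofReal_le_one.2 (by linarith)
    · have hK : 50 * ((H : ℝ) ^ 3 * (nX + nY) * ι) ≤ T * ε ^ 2 := by
        rwa [← mul_div_assoc, div_le_iff₀ (by positivity)] at hT
      have hKT : (nX + nY) * ι ≤ H * T := by
        have h1 : (T : ℝ) * ε ^ 2 ≤ T * (H : ℝ) ^ 2 := by gcongr
        have h2 : (H : ℝ) ^ 2 * (50 * (H * ((nX + nY) * ι))) ≤ (H : ℝ) ^ 2 * T := by
          calc _ = 50 * ((H : ℝ) ^ 3 * (nX + nY) * ι) := by ring
            _ ≤ _ := by linarith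
        have h3 := le_of_mul_le_mul_left h2 (by positivity)
        have h4 : 0 ≤ (nX + nY) * ι := by positivity
        nlinarith
      obtain ⟨hlX, hX1⟩ := hlog hcA hnA
      obtain ⟨hlY, hY1⟩ := hlog hcB hnB
      have hnX0 : 0 < nX := by linarith
      have hnY0 : 0 < nY := by linarith
      have hX2 : nX * ιX ≤ nX * ι := mul_le_mul_of_nonneg_left hιX.2 hnX0.le
      have hY2 : nY * ιY ≤ nY * ι := mul_le_mul_of_nonneg_left hιY.2 hnY0.le
      have hXK : nX * ιX ≤ (nX + nY) * ι := by
        nlinarith [mul_pos hnY0 (show 0 < ι by linarith)]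
      have hYK : nY * ιY ≤ (nX + nY) * ι := by
        nlinarith [mul_pos hnX0 (show 0 < ι by linarith)]
      obtain ⟨hηX0, hηX1, R1, hR1, hR1s, hR1e⟩ := regret_bound_le hH hT0' hnX0
        (show 0 < ιX by linarith [hιX.1]) hXK hKT
      obtain ⟨hηY0, hηY1, R2, hR2, hR2s, hR2e⟩ := regret_bound_le hH hT0' hnY0
        (show 0 < ιY by linarith [hιY.1]) hYK hKT
      rw [← hηX] at hηX0 hηX1 hR1e
      rw [← hηY] at hηY0 hηY1 hR2e
      have hbX := hplay.isRun_max.measure_regret_le G.H_pos hηX0 hηX1 (hlX.trans hιX.1)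
      have hbY := hplay.isRun_min.measure_regret_le G.H_pos hηY0 hηY1 (hlY.trans hιY.1)
      rw [hnX, hR1e] at hbX
      rw [hnY, hR2e] at hbY
      have hdX := hbX.trans (ENNReal.ofReal_le_ofReal (two_mul_exp_neg_le hnX0 hδ hιX.1))
      have hdY := hbY.trans (ENNReal.ofReal_le_ofReal (two_mul_exp_neg_le hnY0 hδ hιY.1))
      have hR : 5 * R1 + 5 * R2 ≤ ε * T := by
        refine abs_le_of_sq_le_sq' ?_ (by positivity) |>.2
        have h1 : R1 ^ 2 + R2 ^ 2 ≤ H ^ 3 * T * ((nX + nY) * ι) := by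
          rw [hR1s, hR2s, ← mul_add]
          exact mul_le_mul_of_nonneg_left (by linarith) (by positivity)
        have h2 : 50 * (H ^ 3 * T * ((nX + nY) * ι)) ≤ (ε * T) ^ 2 := by
          calc _ = T * (50 * ((H : ℝ) ^ 3 * (nX + nY) * ι)) := by ring
            _ ≤ T * (T * ε ^ 2) := mul_le_mul_of_nonneg_left hK hT0'.le
            _ = (ε * T) ^ 2 := by ring
        calc (5 * R1 + 5 * R2) ^ 2 = 50 * (R1 ^ 2 + R2 ^ 2) - 25 * (R1 - R2) ^ 2 := by ring
          _ ≤ 50 * (R1 ^ 2 + R2 ^ 2) := by linarith [sq_nonneg (R1 - R2)]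
          _ ≤ 50 * (H ^ 3 * T * ((nX + nY) * ι)) := by linarith
          _ ≤ (ε * T) ^ 2 := h2
      refine ofReal_one_sub_le_measure hδ.le hdX hdY fun ω h1 h2 =>
        G.isApproxNash_of_le (hpX ω) (hpY ω) fun μ' ν' hμ' hν' => ?_
      · replace h1 := h1 μ' hμ'
        replace h2 := h2 ν' hν'
        have hvX := G.value_average_left hT0
          (G.maxPolicy_pos ηX (fun e => d e ω) (fun e => r e ω)) ν'
        have hvY := G.value_average_right hT0
          (G.minPolicy_pos ηY (fun e => d e ω) (fun e => r e ω)) μ'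
        change ∑ t ∈ Finset.range T, (G.maxView.value (G.maxKernel
          (G.minPolicy ηY (fun e => d e ω) (fun e => r e ω) t)) μ' - G.maxView.value (G.maxKernel
          (G.minPolicy ηY (fun e => d e ω) (fun e => r e ω) t))
            (G.maxPolicy ηX (fun e => d e ω) (fun e => r e ω) t)) ≤ _ at h1
        change ∑ t ∈ Finset.range T, (G.minView.value (G.minKernel
          (G.maxPolicy ηX (fun e => d e ω) (fun e => r e ω) t)) ν' - G.minView.value (G.minKernel
          (G.maxPolicy ηX (fun e => d e ω) (fun e => r e ω) t))
            (G.minPolicy ηY (fun e => d e ω) (fun e => r e ω) t)) ≤ _ at h2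
        simp_rw [TreeGame.maxView_value, Finset.sum_sub_distrib] at h1
        simp_rw [G.minView_value (G.isPolicy_maxPolicy _ _ _ _) hν',
          G.minView_value (G.isPolicy_maxPolicy _ _ _ _) (G.isPolicy_minPolicy _ _ _ _),
          sub_sub_sub_cancel_left, Finset.sum_sub_distrib] at h2
        -- After multiplication by `T`, the sums of V(μ^t, ν^t) in the two regret bounds cancel when
        -- these are added.
        refine le_of_mul_le_mul_right ?_ hT0'
        rw [sub_mul, hvX, hvY]
        linarith
  · intro hεH
    set z := (H : ℝ) ^ 3 * (nX + nY) * ι / ε ^ 2 with hz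
    have hz1 : 1 ≤ z := by
      rw [hz, le_div_iff₀ (by positivity), one_mul]
      calc ε ^ 2 ≤ (H : ℝ) ^ 2 := by gcongr
        _ ≤ (H : ℝ) ^ 3 := pow_le_pow_right₀ hH (by norm_num)
        _ = (H : ℝ) ^ 3 * 1 * 1 := by ring
        _ ≤ (H : ℝ) ^ 3 * (nX + nY) * ι := by gcongr; linarith
    have h1 := (Nat.ceil_lt_add_one (show 0 ≤ 50 * z by linarith)).le
    have e : (H : ℝ) ^ 4 * (nX + nY) * ι / ε ^ 2 = H * z := by rw [hz]; ring
    rw [e, numEpisodes]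
    push_cast
    calc 2 * (H : ℝ) * (⌈50 * z⌉₊ : ℝ) ≤ 2 * H * (51 * z) := by gcongr; linarith
      _ = 102 * (H * z) := by ring
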